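/- Let $g:\mathbb R\to\mathbb R$ be nondecreasing and left-continuous, with Lebesgue--Stieltjes measure $\mu_g$ ($\mu_g([c,d))=g(d)-g(c)$), and $\Delta g(t)=g(t^+)-g(t)$. Let $D_g=\{t:\Delta g(t)>0\}$, let $C_g$ be the open set of points around which $g$ is constant, let $(a_n,b_n)$ be the connected components of $C_g$, and let $N_g^-$ (resp. $N_g^+$) be the set of the finite $a_n$ (resp. $b_n$) that are not in $D_g$. Let $T>0$ with $0\notin D_g\cup N_g^-$ and $T\notin N_g^+\cup D_g\cup C_g$. Put $t^*=b_n$ for $t\in(a_n,b_n)$ and $t^*=t$ for $t\notin C_g$. For $f:[0,T]\to\mathbb C$ the $g$-derivative at $t\in[0,T]$ is, when the limit exists, $f'_g(t)=\lim_{s\to t^{*+}}\frac{f(s)-f(t^*)}{g(s)-g(t^*)}$ if $t\in D_g\cup C_g$, and $f'_g(t)=\lim_{s\to t}\frac{f(s)-f(t)}{g(s)-g(t)}$ otherwise, the latter limit being over $s\in[0,T]$ with $g(s)\ne g(t)$ (thus one-sided at points of $N_g^\pm\cup\{0,T\}$). A function $f$ is $g$-continuous on $[0,T]$ if for all $t\in[0,T]$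 and $\varepsilon>0$ there is $\delta>0$ with $|f(t)-f(s)|<\varepsilon$ whenever $s\in[0,T]$ and $|g(t)-g(s)|<\delta$; $\mathcal{BC}^2_g([0,T];\mathbb C)$ is the set of $f$ such that $f,f'_g,f''_g$ exist on the whole of $[0,T]$ and are bounded and $g$-continuous there. For $\lambda\in\mathbb C$ with $1+\lambda\Delta g\neq0$ on $[0,T]\cap D_g$, the $g$-exponential is $\exp_g(\lambda;t)=\exp\left(\int_{[0,t)}\tilde\lambda\,d\mu_g\right)$, where $\tilde\lambda(s)=\lambda$ for $s\notin D_g$ and $\tilde\lambda(s)=\ln(1+\lambda\Delta g(s))/\Delta g(s)$ for $s\in D_g$ (principal branch). Let $t_1\in[0,T]\cap D_g$ and $w_1,w_2\in\mathbb R\setminus\{0\}$, and let $w_0=w_1$ on $[0,t_1]$ and $w_0=w_2$ on $(t_1,T]$. Let $\lambda_j^1=iw_j$, $\lambda_j^2=-iw_j$ for $j=1,2$ and, for $k=1,2$, \[\alpha_1^k=\frac{\exp_g(\lambda_1^k;t_1)(1+\lambda_1^k\Delta g(t_1))(\lambda_2^2-\lambda_1^k)}{\exp_g(\lambda_2^1;t_1)(1+\lambda_2^1\Delta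 g(t_1))(\lambda_2^2-\lambda_2^1)},\qquad \alpha_2^k=\frac{\exp_g(\lambda_1^k;t_1)(1+\lambda_1^k\Delta g(t_1))(\lambda_1^k-\lambda_2^1)}{\exp_g(\lambda_2^2;t_1)(1+\lambda_2^2\Delta g(t_1))(\lambda_2^2-\lambda_2^1)}.\] Then the maps \[y_k=\exp_g(\lambda_1^k;\cdot)\,\chi_{[0,t_1]}+\left(\alpha_1^k\exp_g(\lambda_2^1;\cdot)+\alpha_2^k\exp_g(\lambda_2^2;\cdot)\right)\chi_{(t_1,T]},\quad k=1,2,\] are two linearly independent (over $\mathbb C$, as functions on $[0,T]$) solutions of $v''_g(t)+w_0(t)^2v(t)=0$, $t\in[0,T]$, where a solution is a $v\in\mathcal{BC}_g^2([0,T];\mathbb C)$ satisfying the equation at every $t\in[0,T]$. Moreover, for all $x_0,v_0\in\mathbb C$, \[v_h=\frac{\lambda_1^2x_0-v_0}{\lambda_1^2-\lambda_1^1}\,y_1+\frac{v_0-\lambda_1^1x_0}{\lambda_1^2-\lambda_1^1}\,y_2\] is the unique solution on $[0,T]$ of this equation with $v(0)=x_0$, $v'_g(0)=v_0$. -/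

import Mathlib

open Set Filter Topology MeasureTheory

noncomputable section

/-- A derivator: a nondecreasing, left-continuous function `g : ℝ → ℝ`. -/
structure Derivator where
  toFun : ℝ → ℝ
  mono' : Monotone toFun
  left_continuous' : ∀ x, ContinuousWithinAt toFun (Iic x) x

namespace Derivator

instance : CoeFun Derivator (fun _ => ℝ → ℝ) := ⟨Derivator.toFun⟩

/-- The Lebesgue–Stieltjes measure `μ_g`, with `μ_g [c, d) = g d - g c` (see `measure_Ico`).
Mathlib's `Monotone.stieltjesFunction` is the right-continuous version of `g`; its Stieltjes measure
only depends on the one-sided limits of `g`. -/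
def measure (g : Derivator) : Measure ℝ := g.mono'.stieltjesFunction.measure

theorem leftLim_stieltjes (g : Derivator) (x : ℝ) :
    Function.leftLim g.mono'.stieltjesFunction x = g x := by
  have hgl : Tendsto g (𝓝[<] x) (𝓝 (g x)) :=
    (g.left_continuous' x).mono_left (nhdsWithin_mono _ Iio_subset_Iic_self)
  have h1 : ∀ y, g y ≤ g.mono'.stieltjesFunction y := fun y => by
    rw [Monotone.stieltjesFunction_eq]
    exact g.mono'.le_rightLim le_rfl
  have h2 : ∀ y < x, g.mono'.stieltjesFunction y ≤ g x := fun y hy => by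
    rw [Monotone.stieltjesFunction_eq]
    exact g.mono'.rightLim_le hy
  have ht : Tendsto g.mono'.stieltjesFunction (𝓝[<] x) (𝓝 (g x)) := by
    refine tendsto_of_tendsto_of_tendsto_of_le_of_le' hgl tendsto_const_nhds
      (Eventually.of_forall h1) ?_
    filter_upwards [self_mem_nhdsWithin] with y hy using h2 y hy
  exact tendsto_nhds_unique (g.mono'.stieltjesFunction.mono.tendsto_leftLim x) ht

theorem measure_Ico (g : Derivator) (c d : ℝ) :
    g.measure (Ico c d) = ENNReal.ofReal (g d - g c) := by
  rw [measure, StieltjesFunction.measure_Ico, leftLim_stieltjes, leftLim_stieltjes]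

/-- The jump `Δg(t) = g(t⁺) - g(t)`. -/
def jump (g : Derivator) (t : ℝ) : ℝ := Function.rightLim g t - g t

/-- `C_g`: the points around which `g` is constant. -/
def C (g : Derivator) : Set ℝ := {t | ∃ ε > 0, ∀ s ∈ Ioo (t - ε) (t + ε), g s = g t}

/-- `D_g`: the jump points of `g`. -/
def D (g : Derivator) : Set ℝ := {t | 0 < g.jump t}

/-- `N_g⁻`: the (finite) left end points of the connected components `(a_n, b_n)` of `C_g`
that are not in `D_g`. -/
def Nminus (g : Derivator) : Set ℝ :=
  {a | ∃ t ∈ g.C, IsGLB (ordConnectedComponent g.C t) a} \ g.D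

/-- `N_g⁺`: the (finite) right end points of the connected components `(a_n, b_n)` of `C_g`
that are not in `D_g`. -/
def Nplus (g : Derivator) : Set ℝ :=
  {b | ∃ t ∈ g.C, IsLUB (ordConnectedComponent g.C t) b} \ g.D

open Classical in
/-- `t* = b_n` if `t` lies in the component `(a_n, b_n)` of `C_g`, and `t* = t` if `t ∉ C_g`. -/
def star (g : Derivator) (t : ℝ) : ℝ :=
  if t ∈ g.C then sSup (ordConnectedComponent g.C t) else t

open Classical in
/-- The limit that is taken in the `g`-derivative at `t ∈ [0, T]` of a function on `[0, T]`:
`s → t*` from the right if `t ∈ D_g ∪ C_g`, and otherwise `s → t` within `[0, T]`, over the points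
where the difference quotient is defined, `g s ≠ g t`. (So the limit is one-sided, from the right
at `N_g⁺ ∪ {0}` and from the left at `N_g⁻ ∪ {T}`.) -/
def derivFilter (g : Derivator) (T t : ℝ) : Filter ℝ :=
  if t ∈ g.D ∪ g.C then 𝓝[Icc 0 T ∩ Ioi (g.star t)] (g.star t)
  else 𝓝[{s | s ∈ Icc 0 T ∧ g s ≠ g t}] t

/-- The difference quotient in the `g`-derivative at `t`. -/
def quotient (g : Derivator) (f : ℝ → ℂ) (t s : ℝ) : ℂ :=
  (f s - f (g.star t)) / ((g s - g (g.star t) : ℝ) : ℂ)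

/-- `f : [0, T] → ℂ` is `g`-differentiable at `t`. (Functions on `[0, T]` are represented by
functions on `ℝ`, of which only the values on `[0, T]` are used.) -/
def DifferentiableAt (g : Derivator) (T : ℝ) (f : ℝ → ℂ) (t : ℝ) : Prop :=
  ∃ L : ℂ, Tendsto (g.quotient f t) (g.derivFilter T t) (𝓝 L)

/-- The `g`-derivative `f'_g`; meaningful at the points where `f` is `g`-differentiable. -/
def deriv (g : Derivator) (T : ℝ) (f : ℝ → ℂ) (t : ℝ) : ℂ :=
  limUnder (g.derivFilter T t) (g.quotient f t)

/-- The iterated `g`-derivative `f_g^{(k)}`. -/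
def iterDeriv (g : Derivator) (T : ℝ) : ℕ → (ℝ → ℂ) → ℝ → ℂ
  | 0, f => f
  | k + 1, f => g.deriv T (g.iterDeriv T k f)

/-- `f ∈ 𝒞_g([0, T]; ℂ)`. -/
def ContinuousOn (g : Derivator) (T : ℝ) (f : ℝ → ℂ) : Prop :=
  ∀ t ∈ Icc 0 T, ∀ ε > 0, ∃ δ > 0, ∀ s ∈ Icc 0 T, |g t - g s| < δ → ‖f t - f s‖ < ε

/-- `f ∈ 𝒞^k_g([0, T]; ℂ)`. -/
def MemC (g : Derivator) (T : ℝ) : ℕ → (ℝ → ℂ) → Prop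
  | 0, f => g.ContinuousOn T f
  | k + 1, f => g.MemC T k f ∧
      (∀ t ∈ Icc 0 T, g.DifferentiableAt T (g.iterDeriv T k f) t) ∧
      g.ContinuousOn T (g.iterDeriv T (k + 1) f)

/-- `f ∈ ℬ𝒞^k_g([0, T]; ℂ)`: `f ∈ 𝒞^k_g` and `f_g^{(n)}` is bounded on `[0, T]` for `n ≤ k`. -/
def MemBC (g : Derivator) (T : ℝ) (k : ℕ) (f : ℝ → ℂ) : Prop :=
  g.MemC T k f ∧ ∀ n ≤ k, ∃ M : ℝ, ∀ t ∈ Icc 0 T, ‖g.iterDeriv T n f t‖ ≤ M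

open Classical in
/-- The integrand `p̃` of the `g`-exponential (`Complex.log` is the principal branch). -/
def expIntegrand (g : Derivator) (p : ℝ → ℂ) (s : ℝ) : ℂ :=
  if s ∈ g.D then Complex.log (1 + p s * g.jump s) / g.jump s else p s

/-- The `g`-exponential `exp_g(p; t) = exp (∫_{[0,t)} p̃ dμ_g)`. -/
def gexp (g : Derivator) (p : ℝ → ℂ) (t : ℝ) : ℂ :=
  Complex.exp (∫ s in Ico 0 t, g.expIntegrand p s ∂g.measure)

end Derivator

/-- The piecewise constant coefficient `w₀ = w₁` on `[0, t₁]`, `w₀ = w₂` on `(t₁, T]`. -/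
def helmholtzCoeff (t₁ w₁ w₂ : ℝ) (t : ℝ) : ℝ := if t ≤ t₁ then w₁ else w₂

/-- `v` is a solution on `[0, T]` of `v''_g + w₀² v = 0`. -/
def IsHelmholtzSolution (g : Derivator) (T t₁ w₁ w₂ : ℝ) (v : ℝ → ℂ) : Prop :=
  g.MemBC T 2 v ∧
    ∀ t ∈ Icc 0 T, g.iterDeriv T 2 v t + (helmholtzCoeff t₁ w₁ w₂ t : ℂ) ^ 2 * v t = 0

/-- `v` is a solution of `v''_g + w₀² v = 0`, `v(0) = x₀`, `v'_g(0) = v₀`. -/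
def IsHelmholtzIVPSolution (g : Derivator) (T t₁ w₁ w₂ : ℝ) (x₀ v₀ : ℂ) (v : ℝ → ℂ) : Prop :=
  IsHelmholtzSolution g T t₁ w₁ w₂ v ∧ v 0 = x₀ ∧ g.deriv T v 0 = v₀

/-- The exponents `λ^1 = i w` (index `0`) and `λ^2 = -i w` (index `1`). -/
def helmholtzExponent (w : ℝ) : Fin 2 → ℂ := ![Complex.I * w, -(Complex.I * w)]

/-- The coefficient `α_1^k`. -/
def helmholtzAlpha₁ (g : Derivator) (t₁ w₁ w₂ : ℝ) (k : Fin 2) : ℂ :=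
  let l := helmholtzExponent w₁
  let m := helmholtzExponent w₂
  (g.gexp (fun _ => l k) t₁ * (1 + l k * g.jump t₁) * (m 1 - l k)) /
    (g.gexp (fun _ => m 0) t₁ * (1 + m 0 * g.jump t₁) * (m 1 - m 0))

/-- The coefficient `α_2^k`. -/
def helmholtzAlpha₂ (g : Derivator) (t₁ w₁ w₂ : ℝ) (k : Fin 2) : ℂ :=
  let l := helmholtzExponent w₁
  let m := helmholtzExponent w₂
  (g.gexp (fun _ => l k) t₁ * (1 + l k * g.jump t₁) * (l k - m 0)) /
    (g.gexp (fun _ => m 1) t₁ * (1 + m 1 * g.jump t₁) * (m 1 - m 0))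

/-- The functions `y_k = exp_g(λ_1^k; ·) χ_{[0,t₁]}
+ (α_1^k exp_g(λ_2^1; ·) + α_2^k exp_g(λ_2^2; ·)) χ_{(t₁,T]}`. -/
def helmholtzY (g : Derivator) (T t₁ w₁ w₂ : ℝ) (k : Fin 2) (t : ℝ) : ℂ :=
  (Icc 0 t₁).indicator (g.gexp fun _ => helmholtzExponent w₁ k) t +
  (Ioc t₁ T).indicator (fun s =>
    helmholtzAlpha₁ g t₁ w₁ w₂ k * g.gexp (fun _ => helmholtzExponent w₂ 0) s +
    helmholtzAlpha₂ g t₁ w₁ w₂ k * g.gexp (fun _ => helmholtzExponent w₂ 1) s) t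

/-- The combination `v_h = (λ_1^2 x₀ - v₀)/(λ_1^2 - λ_1^1) y_1 + (v₀ - λ_1^1 x₀)/(λ_1^2 - λ_1^1) y_2`. -/
def helmholtzVh (g : Derivator) (T t₁ w₁ w₂ : ℝ) (x₀ v₀ : ℂ) (t : ℝ) : ℂ :=
  let l := helmholtzExponent w₁
  (l 1 * x₀ - v₀) / (l 1 - l 0) * helmholtzY g T t₁ w₁ w₂ 0 t +
    (v₀ - l 0 * x₀) / (l 1 - l 0) * helmholtzY g T t₁ w₁ w₂ 1 t

end

/-! ### Constancy intervals and jumps of a derivator. -/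

namespace Derivator

/-! The exponential with exponent `l = ±iw` has `g`-derivative `l` times itself. Its exponent is a
primitive with respect to `μ_g`, hence Lipschitz in `g`. At a continuity point of `g` the integrand
tends to `l`, and the chain rule applies. At a jump the primitive jumps by `log (1 + l Δg)`, so the
exponential is multiplied by `1 + l Δg`, and dividing the increment by `Δg` gives `l`
(`hasDerivAt_gexp`).

On each side of `t₁` combinations of such exponentials solve the equation. Because `t₁` is a jump
point, gluing is cheap. The `g`-derivative at `t₁` involves only the value at `t₁` and the right
limit there, so it suffices that the two pieces have equal right limits (`hasDerivAt_glue_of_le`).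
The jump also separates the two sides in the pseudometric of `g`, so `g`-continuity survives without
any matching (`ContinuousOn.glue`). The coefficients `α` solve the 2×2 linear system that equates
the right limits of the functions and of their `g`-derivatives.

Uniqueness is a Grönwall argument for the pair formed by a function and its `g`-derivative
(`eqOn_zero_of_norm_deriv_le`). Independence and the formula for `v_h` come from the initial data
`(1, λ_1^k)` of `y_k`, which are independent since `w₁ ≠ 0`. The conditions on `0` and `T` make
every limit defining a `g`-derivative one along a nontrivial filter (`IsAdmissible.neBot`). -/

theorem mono (g : Derivator) {s t : ℝ} (h : s ≤ t) : g s ≤ g t := g.mono' h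

theorem mem_C_iff (g : Derivator) {t : ℝ} : t ∈ g.C ↔ ∀ᶠ s in 𝓝 t, g s = g t := by
  rw [(nhds_basis_Ioo_pos t).eventually_iff]
  exact Iff.rfl

theorem isOpen_C (g : Derivator) : IsOpen g.C := by
  rw [isOpen_iff_mem_nhds]
  intro t ht
  rw [mem_C_iff] at ht
  filter_upwards [ht.eventually_nhds] with s hs
  rw [mem_C_iff]
  filter_upwards [hs] with r hr
  rw [hr, hs.self_of_nhds]

theorem mem_C_of_between (g : Derivator) {a t b : ℝ} (hat : a < t) (htb : t < b)
    (h : g b ≤ g a) : t ∈ g.C := by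
  rw [mem_C_iff]
  filter_upwards [Ioo_mem_nhds hat htb] with s hs
  have h1 := g.mono hs.1.le
  have h2 := g.mono hs.2.le
  have h3 := g.mono hat.le
  have h4 := g.mono htb.le
  linarith

theorem jump_nonneg (g : Derivator) (t : ℝ) : 0 ≤ g.jump t :=
  sub_nonneg.2 (g.mono'.le_rightLim le_rfl)

theorem jump_eq_zero (g : Derivator) {t : ℝ} (ht : t ∉ g.D) : g.jump t = 0 :=
  le_antisymm (not_lt.1 ht) (g.jump_nonneg t)

theorem jump_le (g : Derivator) {s t : ℝ} (h : s < t) : g.jump s ≤ g t - g s :=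
  sub_le_sub_right (g.mono'.rightLim_le h) _

theorem tendsto_sub_right (g : Derivator) (t : ℝ) :
    Tendsto (fun s => g s - g t) (𝓝[>] t) (𝓝 (g.jump t)) :=
  (g.mono'.tendsto_rightLim t).sub_const _

theorem tendsto_left (g : Derivator) (t : ℝ) : Tendsto g (𝓝[≤] t) (𝓝 (g t)) :=
  g.left_continuous' t

theorem continuousAt_of_notMem_D (g : Derivator) {t : ℝ} (ht : t ∉ g.D) : ContinuousAt g t := by
  rw [continuousAt_iff_continuous_left'_right']
  refine ⟨(g.left_continuous' t).mono Iio_subset_Iic_self, ?_⟩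
  have h := g.tendsto_sub_right t
  rw [g.jump_eq_zero ht] at h
  simpa [ContinuousWithinAt] using h.add_const (g t)

theorem notMem_C_of_mem_D (g : Derivator) {t : ℝ} (ht : t ∈ g.D) : t ∉ g.C := by
  intro hC
  rw [mem_C_iff] at hC
  have h1 : Tendsto (fun s => g s - g t) (𝓝[>] t) (𝓝 0) := by
    refine tendsto_const_nhds.congr' ?_
    filter_upwards [hC.filter_mono nhdsWithin_le_nhds] with s hs
    rw [hs, sub_self]
  exact absurd (tendsto_nhds_unique (g.tendsto_sub_right t) h1) (ne_of_gt ht)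

theorem eq_of_Icc_subset_C (g : Derivator) {a b : ℝ} (hab : a ≤ b) (h : Icc a b ⊆ g.C) :
    g b = g a := by
  have hd : ∀ x ∈ Icc a b, HasDerivAt g 0 x := fun x hx =>
    (hasDerivAt_const x (g x)).congr_of_eventuallyEq (g.mem_C_iff.1 (h hx))
  exact constant_of_has_deriv_right_zero
    (fun x hx => (hd x hx).continuousAt.continuousWithinAt)
    (fun x hx => (hd x (Ico_subset_Icc_self hx)).hasDerivWithinAt) b (right_mem_Icc.2 hab)

theorem star_of_notMem_C (g : Derivator) {t : ℝ} (ht : t ∉ g.C) : g.star t = t := if_neg ht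

/-! ### The map `t ↦ t*`. -/

section Star

variable {g : Derivator} {t T : ℝ}

theorem lt_of_mem_component (htT : t ≤ T) (hTC : T ∉ g.C) {y : ℝ}
    (hy : y ∈ ordConnectedComponent g.C t) : y < T := by
  by_contra! h
  exact hTC (hy (mem_uIcc_of_le htT h))

theorem isLUB_star (ht : t ∈ g.C) (htT : t ≤ T) (hTC : T ∉ g.C) :
    IsLUB (ordConnectedComponent g.C t) (g.star t) := by
  rw [star, if_pos ht]
  exact isLUB_csSup ⟨t, self_mem_ordConnectedComponent.2 ht⟩
    ⟨T, fun y hy => (lt_of_mem_component htT hTC hy).le⟩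

/-- `C_g` is open, so if `t*` belonged to it the component of `t` would extend past its own
supremum. The point `T ∉ C_g` bounds the component, so the supremum is genuine. -/
theorem star_notMem_C (htT : t ≤ T) (hTC : T ∉ g.C) : g.star t ∉ g.C := by
  by_cases ht : t ∈ g.C
  · intro hb
    have hlub := isLUB_star ht htT hTC
    obtain ⟨ε, hε, hsub⟩ := Metric.isOpen_iff.1 g.isOpen_C _ hb
    obtain ⟨y, hy, hy1, hy2⟩ := hlub.exists_between (sub_lt_self _ hε)
    have : g.star t + ε / 2 ∈ ordConnectedComponent g.C t := by
      refine (uIcc_subset_uIcc_union_uIcc (b := y)).trans (union_subset hy ?_)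
      refine Subset.trans ?_ hsub
      rw [uIcc_of_le (by linarith), Real.ball_eq_Ioo]
      exact fun z hz => ⟨by linarith [hz.1], by linarith [hz.2]⟩
    linarith [hlub.1 this]
  · rwa [g.star_of_notMem_C ht]

theorem le_star (htT : t ≤ T) (hTC : T ∉ g.C) : t ≤ g.star t := by
  by_cases ht : t ∈ g.C
  · exact (isLUB_star ht htT hTC).1 (self_mem_ordConnectedComponent.2 ht)
  · rw [g.star_of_notMem_C ht]

/-- A point outside `C_g` above `t` is above `t*`. -/
theorem star_le {r : ℝ} (htr : t ≤ r) (hr : r ∉ g.C) : g.star t ≤ r := by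
  by_cases ht : t ∈ g.C
  · exact (isLUB_le_iff (isLUB_star ht htr hr)).2 fun y hy => (lt_of_mem_component htr hr hy).le
  · rwa [g.star_of_notMem_C ht]

theorem lt_star (ht : t ∈ g.C) (htT : t ≤ T) (hTC : T ∉ g.C) : t < g.star t :=
  (le_star htT hTC).lt_of_ne fun h => star_notMem_C htT hTC (h ▸ ht)

/-- `g` is constant on the component up to any `s < t*`, and left-continuity carries the value to
`t*`. -/
theorem apply_star (htT : t ≤ T) (hTC : T ∉ g.C) : g (g.star t) = g t := by
  by_cases ht : t ∈ g.C
  · have hlub := isLUB_star ht htT hTC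
    have hlt := lt_star ht htT hTC
    have h1 : Tendsto g (𝓝[<] g.star t) (𝓝 (g (g.star t))) :=
      (g.tendsto_left _).mono_left (nhdsWithin_mono _ Iio_subset_Iic_self)
    refine tendsto_nhds_unique h1 (tendsto_const_nhds.congr' ?_)
    filter_upwards [Ioo_mem_nhdsLT hlt] with s hs
    obtain ⟨y, hy, hy1, -⟩ := hlub.exists_between hs.2
    refine (g.eq_of_Icc_subset_C hs.1.le (Subset.trans ?_ hy)).symm
    rw [uIcc_of_le (hs.1.le.trans hy1.le)]
    exact Icc_subset_Icc_right hy1.le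
  · rw [g.star_of_notMem_C ht]

theorem lt_apply_of_star_lt (ht : t ∈ g.C) (htT : t ≤ T) (hTC : T ∉ g.C) {s : ℝ}
    (hs : g.star t < s) : g (g.star t) < g s := by
  by_contra! h
  refine star_notMem_C htT hTC (g.mem_C_of_between (lt_star ht htT hTC) hs ?_)
  rwa [← apply_star htT hTC]

end Star

/-- The conditions on the end points of `[0, T]`. -/
structure IsAdmissible (g : Derivator) (T : ℝ) : Prop where
  pos : 0 < T
  zero_notMem : (0 : ℝ) ∉ g.D ∪ g.Nminus
  notMem : T ∉ g.Nplus ∪ g.D ∪ g.C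

/-! ### Nontriviality of the limits in the `g`-derivative. -/

namespace IsAdmissible

variable {g : Derivator} {T : ℝ} (h : g.IsAdmissible T) {t : ℝ}
include h

theorem notMem_C : T ∉ g.C := fun hC => h.notMem (Or.inr hC)

theorem notMem_D : T ∉ g.D := fun hD => h.notMem (Or.inl (Or.inr hD))

theorem lt_of_mem_D (ht : t ≤ T) (hD : t ∈ g.D) : t < T :=
  ht.lt_of_ne fun e => h.notMem_D (e ▸ hD)

theorem star_mem (ht : t ∈ Icc 0 T) : g.star t ∈ Icc 0 T :=
  ⟨ht.1.trans (le_star ht.2 h.notMem_C), star_le ht.2 h.notMem_C⟩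

theorem apply_star (ht : t ∈ Icc 0 T) : g (g.star t) = g t := Derivator.apply_star ht.2 h.notMem_C

theorem star_lt (ht : t ≤ T) (hDC : t ∈ g.D ∪ g.C) : g.star t < T := by
  by_cases hC : t ∈ g.C
  · refine (star_le ht h.notMem_C).lt_of_ne fun e => h.notMem (Or.inl (Or.inl ⟨?_, h.notMem_D⟩))
    exact ⟨t, hC, e ▸ isLUB_star hC ht h.notMem_C⟩
  · rw [g.star_of_notMem_C hC]
    exact h.lt_of_mem_D ht (hDC.resolve_right hC)

/-- If `g` were constant on some `[0, s]`, then `0` would be the left end point of a component of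
`C_g`, hence in `N_g⁻`, as it is not a jump point. -/
theorem lt_apply_right (h0 : (0 : ℝ) ∉ g.C) {s : ℝ} (hs : 0 < s) : g 0 < g s := by
  by_contra! hle
  refine h.zero_notMem (Or.inr ⟨⟨s / 2, g.mem_C_of_between (half_pos hs) (half_lt_self hs) hle,
    ?_, ?_⟩, fun hD => h.zero_notMem (Or.inl hD)⟩)
  · intro y hy
    by_contra! hlt
    exact h0 (hy (mem_uIcc_of_ge hlt.le (half_pos hs).le))
  · intro b hb
    by_contra! hlt
    -- A point of the component strictly below the supposed positive lower bound `b`.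
    have hm : min b (s / 2) / 2 ∈ ordConnectedComponent g.C (s / 2) := by
      intro z hz
      rw [uIcc_of_ge (by linarith [min_le_right b (s / 2)])] at hz
      have : 0 < min b (s / 2) := lt_min hlt (half_pos hs)
      exact g.mem_C_of_between (by linarith [hz.1]) (by linarith [hz.2] : z < s) hle
    have := hb hm
    linarith [min_le_left b (s / 2)]

/-- Mirror image at `T`: constancy of `g` on `[s, T]` would put `T` in `N_g⁺`. -/
theorem apply_lt_apply {s : ℝ} (hs : s < T) : g s < g T := by
  by_contra! hle
  refine h.notMem (Or.inl (Or.inl ⟨⟨(s + T) / 2,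
    g.mem_C_of_between (by linarith) (by linarith) hle, ?_, ?_⟩, h.notMem_D⟩))
  · intro y hy
    exact (lt_of_mem_component (by linarith) h.notMem_C hy).le
  · intro b hb
    by_contra! hlt
    have hm : (max b ((s + T) / 2) + T) / 2 ∈ ordConnectedComponent g.C ((s + T) / 2) := by
      intro z hz
      have h1 : max b ((s + T) / 2) < T := max_lt hlt (by linarith)
      rw [uIcc_of_le (by linarith [le_max_right b ((s + T) / 2)])] at hz
      exact g.mem_C_of_between (by linarith [hz.1] : s < z) (by linarith [hz.2]) hle
    have := hb hm
    linarith [le_max_left b ((s + T) / 2), max_lt hlt (by linarith : (s + T) / 2 < T)]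

/-- This makes `g`-derivatives unique. In the right-sided case there is room because `t* < T`;
otherwise `g` takes values other than `g t` arbitrarily near `t`, at the end points by the strict
inequalities and inside because `t ∉ C_g`. -/
theorem neBot (ht : t ∈ Icc 0 T) : (g.derivFilter T t).NeBot := by
  unfold derivFilter
  split_ifs with hDC
  · have hlt := h.star_lt ht.2 hDC
    refine NeBot.mono (nhdsGT_neBot_of_exists_gt ⟨T, hlt⟩ : (𝓝[>] g.star t).NeBot) ?_
    rw [← nhdsWithin_Ioc_eq_nhdsGT hlt]
    exact nhdsWithin_mono _ fun s hs => ⟨⟨(h.star_mem ht).1.trans hs.1.le, hs.2⟩, hs.1⟩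
  · simp only [mem_union, not_or] at hDC
    rw [← mem_closure_iff_nhdsWithin_neBot, Metric.mem_closure_iff]
    intro ε hε
    rcases ht.1.eq_or_lt with rfl | h0
    · have hp : 0 < min T (ε / 2) := lt_min h.pos (half_pos hε)
      refine ⟨min T (ε / 2), ⟨⟨hp.le, min_le_left _ _⟩, (h.lt_apply_right hDC.2 hp).ne'⟩, ?_⟩
      rw [Real.dist_eq, zero_sub, abs_neg, abs_of_pos hp]
      linarith [min_le_right T (ε / 2)]
    rcases ht.2.eq_or_lt with rfl | hT
    · have hp : 0 < min t (ε / 2) := lt_min h0 (half_pos hε)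
      refine ⟨t - min t (ε / 2), ⟨⟨by linarith [min_le_left t (ε / 2)], by linarith⟩,
        (h.apply_lt_apply (by linarith)).ne⟩, ?_⟩
      rw [Real.dist_eq, sub_sub_cancel, abs_of_pos hp]
      linarith [min_le_right t (ε / 2)]
    · by_contra! hcon
      apply hDC.2
      rw [mem_C_iff]
      filter_upwards [Ioo_mem_nhds h0 hT, Metric.ball_mem_nhds t hε] with s hs hsε
      by_contra hne
      have := hcon s ⟨Ioo_subset_Icc_self hs, hne⟩
      rw [Metric.mem_ball, dist_comm] at hsε
      linarith

/-- A common bound for both branches of the definition: the limit is at `t*`, inside `[0, T]`, with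
nonzero denominators. -/
theorem derivFilter_le (ht : t ∈ Icc 0 T) :
    g.derivFilter T t ≤ 𝓝[{s | s ∈ Icc 0 T ∧ g s ≠ g (g.star t)}] g.star t := by
  unfold derivFilter
  split_ifs with hDC
  · by_cases hC : t ∈ g.C
    · exact nhdsWithin_mono _ fun s hs => ⟨hs.1, (lt_apply_of_star_lt hC ht.2 h.notMem_C hs.2).ne'⟩
    · rw [g.star_of_notMem_C hC]
      refine nhdsWithin_mono _ fun s hs => ⟨hs.1, ?_⟩
      have h1 : 0 < g.jump t := hDC.resolve_right hC
      have h2 := g.jump_le hs.2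
      intro e
      rw [e] at h2
      linarith
  · rw [g.star_of_notMem_C fun hC => hDC (Or.inr hC)]

omit h in
theorem derivFilter_le_right (hD : g.star t ∈ g.D) : g.derivFilter T t ≤ 𝓝[>] g.star t := by
  unfold derivFilter
  split_ifs with hDC
  · exact nhdsWithin_mono _ inter_subset_right
  · exfalso
    rw [g.star_of_notMem_C fun hC => hDC (Or.inr hC)] at hD
    exact hDC (Or.inl hD)

theorem eventually_mem (ht : t ∈ Icc 0 T) : ∀ᶠ s in g.derivFilter T t, s ∈ Icc 0 T :=
  h.derivFilter_le ht (by filter_upwards [self_mem_nhdsWithin] with s hs using hs.1)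

theorem eventually_ne (ht : t ∈ Icc 0 T) :
    ∀ᶠ s in g.derivFilter T t, g s ≠ g (g.star t) :=
  h.derivFilter_le ht (by filter_upwards [self_mem_nhdsWithin] with s hs using hs.2)

theorem derivFilter_le_nhds (ht : t ∈ Icc 0 T) : g.derivFilter T t ≤ 𝓝 (g.star t) :=
  (h.derivFilter_le ht).trans nhdsWithin_le_nhds

end IsAdmissible

/-! ### Calculus of `g`-derivatives and `g`-continuity. -/

/-- `f` has `g`-derivative `L` at `t`. -/
def HasDerivAt (g : Derivator) (T : ℝ) (f : ℝ → ℂ) (L : ℂ) (t : ℝ) : Prop :=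
  Tendsto (g.quotient f t) (g.derivFilter T t) (𝓝 L)

variable {g : Derivator} {T t : ℝ} {f f' : ℝ → ℂ} {L L' : ℂ}

theorem HasDerivAt.differentiableAt (hf : g.HasDerivAt T f L t) : g.DifferentiableAt T f t := ⟨L, hf⟩

theorem HasDerivAt.deriv (h : g.IsAdmissible T) (ht : t ∈ Icc 0 T) (hf : g.HasDerivAt T f L t) :
    g.deriv T f t = L := by
  have := h.neBot ht
  exact hf.limUnder_eq

theorem DifferentiableAt.hasDerivAt (hf : g.DifferentiableAt T f t) :
    g.HasDerivAt T f (g.deriv T f t) t := tendsto_nhds_limUnder hf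

theorem HasDerivAt.congr (h : g.IsAdmissible T) (ht : t ∈ Icc 0 T) (hf : g.HasDerivAt T f L t)
    (hff' : EqOn f' f (Icc 0 T)) : g.HasDerivAt T f' L t := by
  refine Tendsto.congr' ?_ hf
  filter_upwards [h.eventually_mem ht] with s hs
  rw [quotient, quotient, hff' hs, hff' (h.star_mem ht)]

theorem HasDerivAt.add (hf : g.HasDerivAt T f L t) (hf' : g.HasDerivAt T f' L' t) :
    g.HasDerivAt T (fun s => f s + f' s) (L + L') t := by
  refine (Tendsto.add hf hf').congr fun s => ?_
  simp only [quotient]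
  ring

theorem HasDerivAt.const_mul (c : ℂ) (hf : g.HasDerivAt T f L t) :
    g.HasDerivAt T (fun s => c * f s) (c * L) t := by
  refine (Tendsto.const_mul c hf).congr fun s => ?_
  simp only [quotient]
  ring

theorem ContinuousOn.congr (hf : g.ContinuousOn T f) (hff' : EqOn f' f (Icc 0 T)) :
    g.ContinuousOn T f' := by
  intro t ht ε hε
  obtain ⟨δ, hδ, H⟩ := hf t ht ε hε
  refine ⟨δ, hδ, fun s hs hst => ?_⟩
  rw [hff' ht, hff' hs]
  exact H s hs hst

theorem ContinuousOn.add (hf : g.ContinuousOn T f) (hf' : g.ContinuousOn T f') :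
    g.ContinuousOn T (fun s => f s + f' s) := by
  intro t ht ε hε
  obtain ⟨δ, hδ, H⟩ := hf t ht (ε / 2) (half_pos hε)
  obtain ⟨δ', hδ', H'⟩ := hf' t ht (ε / 2) (half_pos hε)
  refine ⟨min δ δ', lt_min hδ hδ', fun s hs hst => ?_⟩
  have h1 := H s hs (hst.trans_le (min_le_left _ _))
  have h2 := H' s hs (hst.trans_le (min_le_right _ _))
  calc ‖f t + f' t - (f s + f' s)‖ = ‖(f t - f s) + (f' t - f' s)‖ := by ring_nf
    _ ≤ ‖f t - f s‖ + ‖f' t - f' s‖ := norm_add_le _ _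
    _ < ε := by linarith

theorem ContinuousOn.const_mul (c : ℂ) (hf : g.ContinuousOn T f) :
    g.ContinuousOn T (fun s => c * f s) := by
  intro t ht ε hε
  obtain ⟨δ, hδ, H⟩ := hf t ht (ε / (‖c‖ + 1)) (by positivity)
  refine ⟨δ, hδ, fun s hs hst => ?_⟩
  have h1 := H s hs hst
  rw [lt_div_iff₀ (by positivity)] at h1
  rw [← mul_sub, norm_mul]
  nlinarith [norm_nonneg (f t - f s), norm_nonneg c]

theorem ContinuousOn.eq_of_apply_eq (hf : g.ContinuousOn T f) {s : ℝ} (ht : t ∈ Icc 0 T)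
    (hs : s ∈ Icc 0 T) (hst : g s = g t) : f s = f t := by
  by_contra hne
  have hpos : 0 < ‖f t - f s‖ := norm_pos_iff.2 (sub_ne_zero.2 (Ne.symm hne))
  obtain ⟨δ, hδ, H⟩ := hf t ht _ hpos
  exact lt_irrefl _ (H s hs (by simpa [hst] using hδ))

end Derivator

/-! ### The `g`-exponential with imaginary exponent. -/

theorem exists_norm_log_one_add_I_mul_le (w : ℝ) :
    ∃ K, 0 ≤ K ∧ ∀ x : ℝ, 0 ≤ x → ‖Complex.log (1 + Complex.I * w * x)‖ ≤ K * x := by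
  -- For `|w| x ≤ 1/2` the power series bound suffices. Beyond that the real part of the logarithm
  -- is at most `|w| x`, and its imaginary part at most `π ≤ 2π |w| x`.
  refine ⟨(2 + 2 * Real.pi) * |w|, by positivity, fun x hx => ?_⟩
  have hz : ‖Complex.I * w * x‖ = |w| * x := by simp [abs_of_nonneg hx]
  have hwx : 0 ≤ |w| * x := by positivity
  have hpi := Real.pi_pos
  rcases le_or_gt (|w| * x) (1 / 2) with hle | hgt
  · have := Complex.norm_log_one_add_half_le_self (hz.trans_le hle)
    rw [hz] at this
    nlinarith
  · have hre : (1 : ℝ) ≤ ‖1 + Complex.I * w * x‖ := by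
      have := Complex.re_le_norm (1 + Complex.I * w * x)
      simpa using this
    have hup : ‖1 + Complex.I * w * x‖ ≤ 1 + |w| * x := by
      simpa [abs_of_nonneg hx] using norm_add_le (1 : ℂ) (Complex.I * w * x)
    have h1 : |(Complex.log (1 + Complex.I * w * x)).re| ≤ |w| * x := by
      rw [Complex.log_re, abs_of_nonneg (Real.log_nonneg hre)]
      linarith [Real.log_le_sub_one_of_pos (by linarith : 0 < ‖1 + Complex.I * w * x‖)]
    have h2 : |(Complex.log (1 + Complex.I * w * x)).im| ≤ Real.pi := by
      rw [Complex.log_im]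
      exact Complex.abs_arg_le_pi _
    have := Complex.norm_le_abs_re_add_abs_im (Complex.log (1 + Complex.I * w * x))
    nlinarith

theorem one_add_I_mul_mem_slitPlane (w x : ℝ) : 1 + Complex.I * w * x ∈ Complex.slitPlane :=
  Or.inl (by simp)

theorem one_add_I_mul_ne_zero (w x : ℝ) : 1 + Complex.I * w * x ≠ 0 :=
  Complex.slitPlane_ne_zero (one_add_I_mul_mem_slitPlane w x)

namespace Derivator

theorem countable_D (g : Derivator) : g.D.Countable := by
  refine g.mono'.countable_not_continuousAt.mono ?_
  intro t ht (hc : ContinuousAt g t)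
  have h0 : Tendsto (fun s => g s - g t) (𝓝[>] t) (𝓝 (g t - g t)) :=
    (hc.mono_left nhdsWithin_le_nhds).sub_const _
  have := tendsto_nhds_unique (g.tendsto_sub_right t) h0
  rw [sub_self] at this
  exact absurd this (ne_of_gt ht)

theorem measurable_expIntegrand (g : Derivator) (l : ℂ) :
    Measurable (g.expIntegrand fun _ => l) := by
  refine Measurable.measurable_of_countable_ne (measurable_const (a := l)) (g.countable_D.mono ?_)
  intro s hs
  by_contra hD
  exact hs (if_neg hD).symm

/-- Both cases of the integrand come from `log (1 + z) / z` with its removable singularity at `z =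
0` filled in. Its limit where the jumps vanish is then continuity of `dslope`. -/
theorem expIntegrand_eq_dslope (g : Derivator) (l : ℂ) (s : ℝ) :
    g.expIntegrand (fun _ => l) s = l * dslope Complex.log 1 (1 + l * g.jump s) := by
  have h := sub_smul_dslope Complex.log 1 (1 + l * g.jump s)
  rw [add_sub_cancel_left, Complex.log_one, sub_zero, smul_eq_mul] at h
  unfold expIntegrand
  split_ifs with hD
  · have hj : (g.jump s : ℂ) ≠ 0 := Complex.ofReal_ne_zero.2 (ne_of_gt hD)
    rw [← h]
    field_simp
  · rw [g.jump_eq_zero hD, Complex.ofReal_zero, mul_zero, add_zero, dslope_same,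
      (Complex.hasDerivAt_log Complex.one_mem_slitPlane).deriv, inv_one, mul_one]

theorem exists_norm_expIntegrand_le (g : Derivator) (w : ℝ) :
    ∃ K, 0 ≤ K ∧ ∀ s, ‖g.expIntegrand (fun _ => Complex.I * w) s‖ ≤ K := by
  obtain ⟨K, hK, H⟩ := exists_norm_log_one_add_I_mul_le w
  refine ⟨max K |w|, hK.trans (le_max_left _ _), fun s => ?_⟩
  unfold expIntegrand
  split_ifs with hD
  · refine le_trans ?_ (le_max_left _ _)
    rw [norm_div, Complex.norm_real, Real.norm_of_nonneg (g.jump_nonneg s), div_le_iff₀ hD]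
    exact H _ (g.jump_nonneg s)
  · refine le_trans (le_of_eq ?_) (le_max_right _ _)
    simp

/-- The jump at `r` is at most the oscillation of `g` just to the right of `r`, which is small near
a continuity point. -/
theorem tendsto_jump (g : Derivator) {t : ℝ} (ht : t ∉ g.D) : Tendsto g.jump (𝓝 t) (𝓝 0) := by
  rw [Metric.tendsto_nhds]
  intro ε hε
  have hc := Metric.tendsto_nhds.1 (g.continuousAt_of_notMem_D ht) (ε / 2) (half_pos hε)
  filter_upwards [hc.eventually_nhds] with r hr
  obtain ⟨r', hr', hrr'⟩ := ((hr.filter_mono nhdsWithin_le_nhds).and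
    (self_mem_nhdsWithin : Ioi r ∈ 𝓝[>] r)).exists
  have h1 := hr.self_of_nhds
  rw [Real.dist_eq, abs_lt] at h1 hr'
  rw [Real.dist_eq, sub_zero, abs_of_nonneg (g.jump_nonneg r)]
  linarith [g.jump_le hrr']

theorem tendsto_expIntegrand (g : Derivator) (l : ℂ) {t : ℝ} (ht : t ∉ g.D) :
    Tendsto (g.expIntegrand fun _ => l) (𝓝 t) (𝓝 l) := by
  have hlog := Complex.hasDerivAt_log Complex.one_mem_slitPlane
  have hd : Tendsto (dslope Complex.log 1) (𝓝 1) (𝓝 1) := by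
    have := continuousAt_dslope_same.2 hlog.differentiableAt
    rwa [ContinuousAt, dslope_same, hlog.deriv, inv_one] at this
  have hj : Tendsto (fun s => 1 + l * (g.jump s : ℂ)) (𝓝 t) (𝓝 1) := by
    have := ((Complex.continuous_ofReal.tendsto 0).comp (g.tendsto_jump ht)).const_mul l
    simpa using this.const_add 1
  have hm := (hd.comp hj).const_mul l
  rw [mul_one] at hm
  exact hm.congr fun s => (g.expIntegrand_eq_dslope l s).symm

/-- The integral in the exponent of the `g`-exponential of a constant. -/
noncomputable def expPrimitive (g : Derivator) (l : ℂ) (t : ℝ) : ℂ :=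
  ∫ s in Ico 0 t, g.expIntegrand (fun _ => l) s ∂g.measure

theorem measureReal_Ico (g : Derivator) {s t : ℝ} (hst : s ≤ t) :
    g.measure.real (Ico s t) = g t - g s := by
  rw [measureReal_def, measure_Ico, ENNReal.toReal_ofReal (sub_nonneg.2 (g.mono hst))]

theorem measure_Ico_lt_top (g : Derivator) (s t : ℝ) : g.measure (Ico s t) < ⊤ := by
  rw [measure_Ico]
  exact ENNReal.ofReal_lt_top

theorem measureReal_singleton (g : Derivator) (t : ℝ) : g.measure.real {t} = g.jump t := by
  rw [measureReal_def, measure, StieltjesFunction.measure_singleton, leftLim_stieltjes,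
    Monotone.stieltjesFunction_eq, ← jump, ENNReal.toReal_ofReal (g.jump_nonneg t)]

theorem measureReal_Ioo (g : Derivator) {s t : ℝ} (hst : s < t) :
    g.measure.real (Ioo s t) = g t - g s - g.jump s := by
  rw [measureReal_def, measure, StieltjesFunction.measure_Ioo, leftLim_stieltjes,
    Monotone.stieltjesFunction_eq, ENNReal.toReal_ofReal (sub_nonneg.2 (g.mono'.rightLim_le hst)),
    jump]
  ring

theorem integrableOn_expIntegrand (g : Derivator) (w s t : ℝ) :
    IntegrableOn (g.expIntegrand fun _ => Complex.I * w) (Ico s t) g.measure := by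
  obtain ⟨K, -, H⟩ := g.exists_norm_expIntegrand_le w
  exact Measure.integrableOn_of_bounded (g.measure_Ico_lt_top s t).ne
    (g.measurable_expIntegrand _).aestronglyMeasurable (Eventually.of_forall H)

theorem expPrimitive_sub (g : Derivator) (w : ℝ) {s t : ℝ} (hs : 0 ≤ s) (hst : s ≤ t) :
    g.expPrimitive (Complex.I * w) t - g.expPrimitive (Complex.I * w) s =
      ∫ r in Ico s t, g.expIntegrand (fun _ => Complex.I * w) r ∂g.measure := by
  rw [sub_eq_iff_eq_add', expPrimitive, expPrimitive, ← setIntegral_union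
    (Set.disjoint_left.2 fun x hx hx' => (not_lt.2 hx'.1) hx.2) measurableSet_Ico
    (g.integrableOn_expIntegrand w _ _) (g.integrableOn_expIntegrand w _ _),
    Ico_union_Ico_eq_Ico hs hst]

/-- Used with `c = 0` for the Lipschitz bound in `g`, and with `c = iw` for the `g`-derivative of
the primitive. -/
theorem norm_expPrimitive_sub_sub_le (g : Derivator) (w : ℝ) {s t K : ℝ} {c : ℂ} (hs : 0 ≤ s)
    (hst : s ≤ t) (hK : ∀ r ∈ Ico s t, ‖g.expIntegrand (fun _ => Complex.I * w) r - c‖ ≤ K) :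
    ‖g.expPrimitive (Complex.I * w) t - g.expPrimitive (Complex.I * w) s - c * (g t - g s : ℝ)‖
      ≤ K * (g t - g s) := by
  have hc : ∫ _ in Ico s t, c ∂g.measure = c * (g t - g s : ℝ) := by
    rw [setIntegral_const, measureReal_Ico g hst, Complex.real_smul, mul_comm]
  rw [expPrimitive_sub g w hs hst, ← hc, ← integral_sub (g.integrableOn_expIntegrand w s t)
    (integrableOn_const (g.measure_Ico_lt_top s t).ne), ← measureReal_Ico g hst]
  exact norm_setIntegral_le_of_norm_le_const (g.measure_Ico_lt_top s t) hK

theorem exists_norm_expPrimitive_sub_le (g : Derivator) (w : ℝ) :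
    ∃ K, 0 ≤ K ∧ ∀ s t, 0 ≤ s → 0 ≤ t →
      ‖g.expPrimitive (Complex.I * w) t - g.expPrimitive (Complex.I * w) s‖ ≤ K * |g t - g s| := by
  obtain ⟨K, hK, H⟩ := g.exists_norm_expIntegrand_le w
  have key : ∀ s t, 0 ≤ s → s ≤ t →
      ‖g.expPrimitive (Complex.I * w) t - g.expPrimitive (Complex.I * w) s‖ ≤ K * |g t - g s| := by
    intro s t hs hst
    have := g.norm_expPrimitive_sub_sub_le w (c := 0) hs hst (K := K) (fun r _ => by simpa using H r)
    rw [abs_of_nonneg (sub_nonneg.2 (g.mono hst))]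
    simpa using this
  refine ⟨K, hK, fun s t hs ht => ?_⟩
  rcases le_total s t with hst | hst
  · exact key s t hs hst
  · rw [norm_sub_rev, abs_sub_comm]
    exact key t s ht hst

/-- The primitive has `g`-derivative `l` at the points of continuity of `g`. -/
theorem eventually_norm_expPrimitive_sub_le (g : Derivator) (w : ℝ) {t ε : ℝ} (ht0 : 0 ≤ t)
    (ht : t ∉ g.D) (hε : 0 < ε) :
    ∀ᶠ s in 𝓝 t, 0 ≤ s → ‖g.expPrimitive (Complex.I * w) s - g.expPrimitive (Complex.I * w) t -
      Complex.I * w * (g s - g t : ℝ)‖ ≤ ε * |g s - g t| := by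
  have hlim := Metric.tendsto_nhds.1 (g.tendsto_expIntegrand (Complex.I * w) ht) ε hε
  obtain ⟨δ, hδ, H⟩ := Metric.eventually_nhds_iff.1 hlim
  filter_upwards [Metric.ball_mem_nhds t hδ] with s hs hs0
  rw [Metric.mem_ball, Real.dist_eq, abs_lt] at hs
  rcases le_total t s with hst | hst
  · rw [abs_of_nonneg (sub_nonneg.2 (g.mono hst))]
    refine g.norm_expPrimitive_sub_sub_le w ht0 hst fun r hr => ?_
    rw [← dist_eq_norm]
    refine (H ?_).le
    rw [Real.dist_eq, abs_lt]
    constructor <;> linarith [hr.1, hr.2]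
  · rw [abs_of_nonpos (sub_nonpos.2 (g.mono hst)), ← norm_neg]
    have := g.norm_expPrimitive_sub_sub_le w (c := Complex.I * w) (K := ε) hs0 hst fun r hr => ?_
    · rw [neg_sub (g s)]
      refine le_trans (le_of_eq (congrArg norm ?_)) this
      push_cast
      ring
    · rw [← dist_eq_norm]
      refine (H ?_).le
      rw [Real.dist_eq, abs_lt]
      constructor <;> linarith [hr.1, hr.2]

/-- Split `[t, s)` into the atom `{t}`, which contributes exactly the logarithm, and `(t, s)`, whose
mass `g s - g t - Δg(t)` tends to `0` while the integrand stays bounded. -/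
theorem tendsto_expPrimitive_right (g : Derivator) (w : ℝ) {t : ℝ} (ht0 : 0 ≤ t) (ht : t ∈ g.D) :
    Tendsto (fun s => g.expPrimitive (Complex.I * w) s - g.expPrimitive (Complex.I * w) t) (𝓝[>] t)
      (𝓝 (Complex.log (1 + Complex.I * w * g.jump t))) := by
  obtain ⟨K, hK, H⟩ := g.exists_norm_expIntegrand_le w
  have hz : Tendsto (fun s => K * (g s - g t - g.jump t)) (𝓝[>] t) (𝓝 0) := by
    simpa using ((g.tendsto_sub_right t).sub_const (g.jump t)).const_mul K
  rw [tendsto_iff_norm_sub_tendsto_zero]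
  refine squeeze_zero' (Eventually.of_forall fun s => norm_nonneg _) ?_ hz
  filter_upwards [self_mem_nhdsWithin] with s (hs : t < s)
  have hint := g.integrableOn_expIntegrand w t s
  have hsplit : Ico t s = {t} ∪ Ioo t s := by
    rw [← Ioo_insert_left hs, singleton_union]
  have hj : (g.jump t : ℂ) ≠ 0 := Complex.ofReal_ne_zero.2 (ne_of_gt ht)
  have hlog : g.jump t • g.expIntegrand (fun _ => Complex.I * w) t =
      Complex.log (1 + Complex.I * w * g.jump t) := by
    rw [expIntegrand, if_pos ht, Complex.real_smul, mul_div_cancel₀ _ hj]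
  rw [expPrimitive_sub g w ht0 hs.le, hsplit, setIntegral_union (by simp) measurableSet_Ioo
    (hint.mono_set (by simp [hsplit])) (hint.mono_set Ioo_subset_Ico_self), integral_singleton,
    measureReal_singleton, hlog, add_sub_cancel_left, ← measureReal_Ioo g hs]
  exact norm_setIntegral_le_of_norm_le_const
    ((measure_mono Ioo_subset_Ico_self).trans_lt (g.measure_Ico_lt_top t s)) fun r _ => H r

theorem gexp_eq (g : Derivator) (l : ℂ) (t : ℝ) :
    g.gexp (fun _ => l) t = Complex.exp (g.expPrimitive l t) := rfl

theorem gexp_ne_zero (g : Derivator) (l : ℂ) (t : ℝ) : g.gexp (fun _ => l) t ≠ 0 :=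
  Complex.exp_ne_zero _

theorem gexp_zero (g : Derivator) (l : ℂ) : g.gexp (fun _ => l) 0 = 1 := by
  simp [gexp]

theorem gexp_eq_mul (g : Derivator) (l : ℂ) (s t : ℝ) : g.gexp (fun _ => l) s =
    g.gexp (fun _ => l) t * Complex.exp (g.expPrimitive l s - g.expPrimitive l t) := by
  rw [gexp_eq, gexp_eq, ← Complex.exp_add, add_sub_cancel]

theorem tendsto_gexp_right (g : Derivator) (w : ℝ) {t : ℝ} (ht0 : 0 ≤ t) (ht : t ∈ g.D) :
    Tendsto (g.gexp fun _ => Complex.I * w) (𝓝[>] t)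
      (𝓝 (g.gexp (fun _ => Complex.I * w) t * (1 + Complex.I * w * g.jump t))) := by
  have h1 := ((Complex.continuous_exp.tendsto _).comp
    (g.tendsto_expPrimitive_right w ht0 ht)).const_mul (g.gexp (fun _ => Complex.I * w) t)
  rw [Complex.exp_log (one_add_I_mul_ne_zero w _)] at h1
  exact h1.congr fun s => (g.gexp_eq_mul _ s t).symm

theorem exists_norm_gexp_le (g : Derivator) (w : ℝ) {T : ℝ} :
    ∃ M, ∀ t ∈ Icc 0 T, ‖g.gexp (fun _ => Complex.I * w) t‖ ≤ M := by
  obtain ⟨K, hK, H⟩ := g.exists_norm_expPrimitive_sub_le w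
  refine ⟨Real.exp (K * (g T - g 0)), fun t ht => ?_⟩
  rw [gexp_eq, Complex.norm_exp, Real.exp_le_exp]
  refine (Complex.re_le_norm _).trans ?_
  have h1 := H 0 t le_rfl ht.1
  have h2 : g.expPrimitive (Complex.I * w) 0 = 0 := by simp [expPrimitive]
  rw [h2, sub_zero, abs_of_nonneg (sub_nonneg.2 (g.mono ht.1))] at h1
  exact h1.trans (by gcongr; exact g.mono ht.2)

theorem tendsto_expPrimitive (g : Derivator) (w : ℝ) {t : ℝ} (ht : 0 ≤ t) {l : Filter ℝ}
    (hl : ∀ᶠ s in l, 0 ≤ s) (hg : Tendsto g l (𝓝 (g t))) :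
    Tendsto (fun s => g.expPrimitive (Complex.I * w) s - g.expPrimitive (Complex.I * w) t) l
      (𝓝 0) := by
  obtain ⟨K, hK, H⟩ := g.exists_norm_expPrimitive_sub_le w
  rw [tendsto_zero_iff_norm_tendsto_zero]
  have hz : Tendsto (fun s => K * |g s - g t|) l (𝓝 0) := by
    simpa using (hg.sub_const (g t)).abs.const_mul K
  refine squeeze_zero' (Eventually.of_forall fun s => norm_nonneg _) ?_ hz
  filter_upwards [hl] with s hs using H t s ht hs

theorem continuousOn_gexp (g : Derivator) (w T : ℝ) :
    g.ContinuousOn T (g.gexp fun _ => Complex.I * w) := by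
  intro t ht ε hε
  -- `g`-continuity at `t` is continuity for the topology that `g` induces on `[0, T]`.
  have hg : Tendsto g (comap g (𝓝 (g t)) ⊓ 𝓟 (Icc 0 T)) (𝓝 (g t)) :=
    tendsto_comap.mono_left inf_le_left
  have h1 := (g.tendsto_expPrimitive w ht.1
    (l := comap g (𝓝 (g t)) ⊓ 𝓟 (Icc 0 T)) (mem_inf_of_right fun s hs => hs.1) hg)
  have h2 := ((Complex.continuous_exp.tendsto _).comp h1).const_mul
    (g.gexp (fun _ => Complex.I * w) t)
  rw [Complex.exp_zero, mul_one] at h2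
  have h3 := Metric.tendsto_nhds.1 (h2.congr fun s => (g.gexp_eq_mul _ s t).symm) ε hε
  rw [eventually_inf_principal, eventually_comap] at h3
  obtain ⟨δ, hδ, H⟩ := Metric.eventually_nhds_iff.1 h3
  refine ⟨δ, hδ, fun s hs hst => ?_⟩
  rw [← dist_eq_norm, dist_comm]
  refine H ?_ s rfl hs
  rwa [dist_comm]

theorem hasDerivAt_gexp {g : Derivator} {T : ℝ} (h : g.IsAdmissible T) (w : ℝ) {t : ℝ}
    (ht : t ∈ Icc 0 T) : g.HasDerivAt T (g.gexp fun _ => Complex.I * w)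
      (Complex.I * w * g.gexp (fun _ => Complex.I * w) t) t := by
  have hu := h.star_mem ht
  -- A `g`-continuous function agrees at `t` and `t*`, so only `u = t*` matters from here on.
  rw [← (g.continuousOn_gexp w T).eq_of_apply_eq ht hu (h.apply_star ht)]
  set u := g.star t with hu_def
  have hmem := h.eventually_mem ht
  have hne := h.eventually_ne ht
  have hnhds := h.derivFilter_le_nhds ht
  rw [← hu_def] at hne hnhds
  by_cases hD : u ∈ g.D
  · have hle := IsAdmissible.derivFilter_le_right (T := T) (t := t) hD
    rw [← hu_def] at hle
    have hj : (g.jump u : ℂ) ≠ 0 := Complex.ofReal_ne_zero.2 (ne_of_gt hD)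
    have h1 := ((g.tendsto_gexp_right w hu.1 hD).sub_const (g.gexp (fun _ => Complex.I * w) u)).div
      ((Complex.continuous_ofReal.tendsto _).comp (g.tendsto_sub_right u)) hj
    have h2 := h1.mono_left hle
    have e : (g.gexp (fun _ => Complex.I * w) u * (1 + Complex.I * w * g.jump u) -
      g.gexp (fun _ => Complex.I * w) u) / (g.jump u : ℂ) =
      Complex.I * w * g.gexp (fun _ => Complex.I * w) u := by
      field_simp
      ring
    rw [e] at h2
    exact h2
  · have hg : Tendsto g (g.derivFilter T t) (𝓝 (g u)) :=
      (g.continuousAt_of_notMem_D hD).mono_left hnhds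
    have hF := g.tendsto_expPrimitive w hu.1 (hmem.mono fun s hs => hs.1) hg
    -- Chain rule through `dslope`, because the increment of the primitive may vanish and cannot be
    -- divided by.
    have hd : Tendsto (dslope Complex.exp 0) (𝓝 0) (𝓝 1) := by
      have := continuousAt_dslope_same.2 (Complex.hasDerivAt_exp 0).differentiableAt
      rwa [ContinuousAt, dslope_same, (Complex.hasDerivAt_exp 0).deriv, Complex.exp_zero] at this
    have hq : Tendsto (fun s => (g.expPrimitive (Complex.I * w) s -
        g.expPrimitive (Complex.I * w) u) / ((g s - g u : ℝ) : ℂ)) (g.derivFilter T t)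
        (𝓝 (Complex.I * w)) := by
      rw [Metric.tendsto_nhds]
      intro ε hε
      filter_upwards [hmem, hne, hnhds (g.eventually_norm_expPrimitive_sub_le w hu.1 hD
        (half_pos hε))] with s hs hsne hsb
      have hpos : 0 < |g s - g u| := abs_pos.2 (sub_ne_zero.2 hsne)
      have hc : ((g s - g u : ℝ) : ℂ) ≠ 0 := Complex.ofReal_ne_zero.2 (sub_ne_zero.2 hsne)
      rw [dist_eq_norm, div_sub' hc, norm_div, Complex.norm_real, Real.norm_eq_abs,
        div_lt_iff₀ hpos, mul_comm _ (Complex.I * _)]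
      have := hsb hs.1
      nlinarith
    have h1 := ((hd.comp hF).mul hq).const_mul (g.gexp (fun _ => Complex.I * w) u)
    rw [one_mul, mul_comm (g.gexp _ u)] at h1
    refine h1.congr fun s => ?_
    have e := sub_smul_dslope Complex.exp 0
      (g.expPrimitive (Complex.I * w) s - g.expPrimitive (Complex.I * w) u)
    rw [Complex.exp_zero, sub_zero, smul_eq_mul] at e
    rw [quotient, ← hu_def, g.gexp_eq_mul _ s u, Function.comp_apply, ← mul_sub_one, ← e]
    ring

end Derivator

/-! ### Grönwall inequality and uniqueness. -/

namespace Derivator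

/-- A division-free form of differentiability from the right. It also covers points `s` with `g s =
g x`, where `g`-continuity forces `f s = f x`, and hence all `x ∈ C_g`. -/
theorem HasDerivAt.eventually_norm_sub_le {g : Derivator} {T : ℝ} {f : ℝ → ℂ} {L : ℂ} {x η : ℝ}
    (hx : x ∈ Ico 0 T) (hf : g.HasDerivAt T f L x) (hfc : g.ContinuousOn T f) (hη : 0 < η) :
    ∀ᶠ s in 𝓝[>] x, ‖f s - f x - L * (g s - g x : ℝ)‖ ≤ η * (g s - g x) := by
  have hmem : ∀ᶠ s in 𝓝[>] x, s ∈ Icc 0 T := by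
    filter_upwards [Ioc_mem_nhdsGT hx.2] with s hs using ⟨hx.1.trans hs.1.le, hs.2⟩
  have hsame : ∀ s ∈ Icc 0 T, g s = g x → ‖f s - f x - L * (g s - g x : ℝ)‖ ≤ η * (g s - g x) := by
    intro s hs e
    simp [hfc.eq_of_apply_eq (Ico_subset_Icc_self hx) hs e, e]
  by_cases hC : x ∈ g.C
  · filter_upwards [hmem, (g.mem_C_iff.1 hC).filter_mono nhdsWithin_le_nhds] with s hs e
    exact hsame s hs e
  · have hq := Metric.tendsto_nhds.1 hf η hη
    have hev : ∀ᶠ s in 𝓝[>] x, g s ≠ g x → dist (g.quotient f x s) L < η := by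
      unfold derivFilter at hq
      rw [g.star_of_notMem_C hC] at hq
      split_ifs at hq
      · rw [eventually_nhdsWithin_iff] at hq
        filter_upwards [hq.filter_mono nhdsWithin_le_nhds, hmem, self_mem_nhdsWithin]
          with s hs hs1 hs2 _ using hs ⟨hs1, hs2⟩
      · rw [eventually_nhdsWithin_iff] at hq
        filter_upwards [hq.filter_mono nhdsWithin_le_nhds, hmem] with s hs hs1 hne
          using hs ⟨hs1, hne⟩
    filter_upwards [hev, hmem, self_mem_nhdsWithin] with s hs hs1 (hs2 : x < s)
    by_cases e : g s = g x
    · exact hsame s hs1 e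
    have hpos : 0 < g s - g x := (sub_nonneg.2 (g.mono hs2.le)).lt_of_ne (sub_ne_zero.2 e).symm
    have hc : ((g s - g x : ℝ) : ℂ) ≠ 0 := Complex.ofReal_ne_zero.2 hpos.ne'
    have := hs e
    rw [quotient, g.star_of_notMem_C hC, dist_eq_norm, div_sub' hc, norm_div, Complex.norm_real,
      Real.norm_of_nonneg hpos.le, div_lt_iff₀ hpos, mul_comm _ L] at this
    exact this.le

theorem ContinuousOn.tendsto_left {g : Derivator} {T t : ℝ} {f : ℝ → ℂ} (hf : g.ContinuousOn T f)
    (ht : t ∈ Ioc 0 T) : Tendsto f (𝓝[<] t) (𝓝 (f t)) := by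
  rw [Metric.tendsto_nhds]
  intro ε hε
  obtain ⟨δ, hδ, H⟩ := hf t (Ioc_subset_Icc_self ht) ε hε
  have hg := Metric.tendsto_nhds.1
    ((g.tendsto_left t).mono_left (nhdsWithin_mono _ Iio_subset_Iic_self)) δ hδ
  filter_upwards [hg, Ioo_mem_nhdsLT ht.1] with s hs hs'
  rw [dist_comm, dist_eq_norm]
  refine H s ⟨hs'.1.le, hs'.2.le.trans ht.2⟩ ?_
  rwa [dist_comm, Real.dist_eq] at hs

/-- A Grönwall inequality for pairs of `g`-differentiable functions. -/
theorem eqOn_zero_of_norm_deriv_le {g : Derivator} {T K : ℝ} {p q p' q' : ℝ → ℂ}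
    (hpc : g.ContinuousOn T p) (hqc : g.ContinuousOn T q)
    (hp : ∀ t ∈ Icc 0 T, g.HasDerivAt T p (p' t) t) (hq : ∀ t ∈ Icc 0 T, g.HasDerivAt T q (q' t) t)
    (hK : 0 ≤ K) (hle : ∀ t ∈ Icc 0 T, ‖p' t‖ + ‖q' t‖ ≤ K * (‖p t‖ + ‖q t‖))
    (hp0 : p 0 = 0) (hq0 : q 0 = 0) : EqOn p 0 (Icc 0 T) := by
  -- The rate `K + 1` instead of `K` leaves room for the first-order error `ε (g s - g x)`, since
  -- the barrier is at least `ε`.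
  have key : ∀ ε > 0, ∀ t ∈ Icc 0 T, ‖p t‖ + ‖q t‖ ≤ ε * Real.exp ((K + 1) * (g t - g 0)) := by
    intro ε hε
    set B : ℝ → ℝ := fun s => ε * Real.exp ((K + 1) * (g s - g 0)) with hB
    have hBmono : Monotone B := fun a b hab => by
      simp only [hB]
      gcongr
      exact g.mono hab
    set S : Set ℝ := {t | ∀ s ∈ Icc 0 t, ‖p s‖ + ‖q s‖ ≤ B s} with hS
    have hSub : Icc 0 T ⊆ S := by
      -- Continuous induction: closedness needs only left-continuity of `p`, `q` and monotonicity of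
      -- the barrier; the advance to the right comes from the `g`-derivatives.
      refine IsClosed.Icc_subset_of_forall_exists_gt ?_ ?_ ?_
      · rw [← closure_subset_iff_isClosed]
        intro t ht
        have htI : t ∈ Icc 0 T :=
          isClosed_Icc.closure_subset (closure_mono inter_subset_right ht)
        refine ⟨?_, htI⟩
        by_contra hnot
        have hlt : ∀ s ∈ Ico 0 t, ‖p s‖ + ‖q s‖ ≤ B s := by
          intro s hs
          obtain ⟨r, hr, hrS⟩ := mem_closure_iff.1 ht (Ioi s) isOpen_Ioi hs.2
          exact hrS.1 s ⟨hs.1, le_of_lt hr⟩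
        apply hnot
        intro s hs
        rcases hs.2.lt_or_eq with hst | rfl
        · exact hlt s ⟨hs.1, hst⟩
        rcases hs.1.lt_or_eq with h0 | rfl
        · have hlim := (hpc.tendsto_left ⟨h0, htI.2⟩).norm.add (hqc.tendsto_left ⟨h0, htI.2⟩).norm
          refine le_of_tendsto hlim ?_
          filter_upwards [Ioo_mem_nhdsLT h0] with r hr
          exact (hlt r ⟨hr.1.le, hr.2⟩).trans (hBmono hr.2.le)
        · simp [hp0, hq0, hB, hε.le]
      · intro s hs
        obtain rfl : s = 0 := le_antisymm hs.2 hs.1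
        simp [hp0, hq0, hB, hε.le]
      · rintro x ⟨hxS, hx⟩ y hy
        have hxI := Ico_subset_Icc_self hx
        have hxB := hxS x ⟨hx.1, le_rfl⟩
        have hloc : ∀ᶠ s in 𝓝[>] x, ‖p s‖ + ‖q s‖ ≤ B s := by
          filter_upwards [(hp x hxI).eventually_norm_sub_le hx hpc (half_pos hε),
            (hq x hxI).eventually_norm_sub_le hx hqc (half_pos hε), self_mem_nhdsWithin]
            with s h1 h2 (hs : x < s)
          set d := g s - g x with hd
          have hd0 : 0 ≤ d := sub_nonneg.2 (g.mono hs.le)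
          have tri : ∀ (f : ℝ → ℂ) (L : ℂ), ‖f s - f x - L * (d : ℂ)‖ ≤ ε / 2 * d →
              ‖f s‖ ≤ ‖f x‖ + ‖L‖ * d + ε / 2 * d := by
            intro f L hf
            calc ‖f s‖ = ‖f x + L * (d : ℂ) + (f s - f x - L * (d : ℂ))‖ := by ring_nf
              _ ≤ ‖f x‖ + ‖L * (d : ℂ)‖ + ‖f s - f x - L * (d : ℂ)‖ := norm_add₃_le
              _ ≤ _ := by
                rw [norm_mul, Complex.norm_real, Real.norm_of_nonneg hd0]
                gcongr
          have h3 := tri p _ h1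
          have h4 := tri q _ h2
          have h5 := mul_le_mul_of_nonneg_right (hle x hxI) hd0
          have hBx : ε ≤ B x := le_mul_of_one_le_right hε.le
            (Real.one_le_exp (mul_nonneg (by linarith) (sub_nonneg.2 (g.mono hx.1))))
          -- `1 + y ≤ exp y` needs no smallness of `y`, so the estimate also crosses jumps, where
          -- `d` does not tend to `0`.
          have hBs : B x * (1 + (K + 1) * d) ≤ B s := by
            have : B s = B x * Real.exp ((K + 1) * d) := by
              simp only [hB, hd]
              rw [mul_assoc, ← Real.exp_add]
              ring_nf
            rw [this]
            exact mul_le_mul_of_nonneg_left (by linarith [Real.add_one_le_exp ((K + 1) * d)])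
              (hε.le.trans hBx)
          have h6 := mul_le_mul_of_nonneg_right hBx hd0
          have h7 := mul_le_mul_of_nonneg_right hxB (mul_nonneg hK hd0)
          nlinarith
        obtain ⟨u, hu, hsub⟩ := mem_nhdsGT_iff_exists_Ioc_subset.1 hloc
        refine ⟨min u y, fun s hs => ?_, lt_min hu hy, min_le_right _ _⟩
        rcases le_or_gt s x with hsx | hsx
        · exact hxS s ⟨hs.1, hsx⟩
        · exact hsub ⟨hsx, hs.2.trans (min_le_left _ _)⟩
    exact fun t ht => hSub ht t ⟨ht.1, le_rfl⟩
  intro t ht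
  have hlim : Tendsto (fun ε : ℝ => ε * Real.exp ((K + 1) * (g t - g 0))) (𝓝[>] 0) (𝓝 0) := by
    have : Continuous fun ε : ℝ => ε * Real.exp ((K + 1) * (g t - g 0)) := by fun_prop
    simpa using (this.tendsto 0).mono_left nhdsWithin_le_nhds
  have h0 : ‖p t‖ + ‖q t‖ ≤ 0 := by
    refine ge_of_tendsto hlim ?_
    filter_upwards [self_mem_nhdsWithin] with ε hε using key ε hε t ht
  exact norm_le_zero_iff.1 (by linarith [norm_nonneg (p t), norm_nonneg (q t)])

/-! ### Gluing at a jump point. -/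

/-- The function that is `f₁` up to `t₁` and `f₂` after `t₁`. -/
noncomputable def glue (t₁ : ℝ) (f₁ f₂ : ℝ → ℂ) (t : ℝ) : ℂ := if t ≤ t₁ then f₁ t else f₂ t

section Glue

variable {g : Derivator} {T t₁ t : ℝ} {f₁ f₂ : ℝ → ℂ} {L A : ℂ}

/-- If `t* < t₁`, only `f₁` is seen. If `t* = t₁`, the quotients of the glued function and of `f₁`
differ by `(f₂ s - f₁ s) / (g s - g t₁)`, which tends to `0 / Δg(t₁) = 0`; the value `f₂ t₁` plays
no role. -/
theorem hasDerivAt_glue_of_le (h : g.IsAdmissible T) (hD : t₁ ∈ g.D) (h₁ : Tendsto f₁ (𝓝[>] t₁) (𝓝 A))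
    (h₂ : Tendsto f₂ (𝓝[>] t₁) (𝓝 A)) (ht : t ∈ Icc 0 T) (htt : t ≤ t₁)
    (hf : g.HasDerivAt T f₁ L t) : g.HasDerivAt T (glue t₁ f₁ f₂) L t := by
  rcases (star_le htt (g.notMem_C_of_mem_D hD)).lt_or_eq with hlt | heq
  · refine Tendsto.congr' ?_ hf
    filter_upwards [h.derivFilter_le_nhds ht (Iio_mem_nhds hlt)] with s (hs : s < t₁)
    rw [quotient, quotient, glue, glue, if_pos hs.le, if_pos hlt.le]
  · have hle : g.derivFilter T t ≤ 𝓝[>] t₁ :=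
      heq ▸ IsAdmissible.derivFilter_le_right (T := T) (t := t) (heq.symm ▸ hD)
    have hj : (g.jump t₁ : ℂ) ≠ 0 := Complex.ofReal_ne_zero.2 (ne_of_gt hD)
    have hz := ((h₂.sub h₁).div
      ((Complex.continuous_ofReal.tendsto _).comp (g.tendsto_sub_right t₁)) hj).mono_left hle
    rw [sub_self, zero_div] at hz
    have hs := Tendsto.add hf hz
    rw [add_zero] at hs
    refine hs.congr' ?_
    filter_upwards [hle self_mem_nhdsWithin] with s (hs : t₁ < s)
    rw [quotient, quotient, heq, glue, glue, if_neg hs.not_ge, if_pos le_rfl, Pi.div_apply,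
      Function.comp_apply]
    ring

theorem hasDerivAt_glue_of_lt (h : g.IsAdmissible T) (ht : t ∈ Icc 0 T) (htt : t₁ < t)
    (hf : g.HasDerivAt T f₂ L t) : g.HasDerivAt T (glue t₁ f₁ f₂) L t := by
  have hlt : t₁ < g.star t := htt.trans_le (le_star ht.2 h.notMem_C)
  refine Tendsto.congr' ?_ hf
  filter_upwards [h.derivFilter_le_nhds ht (Ioi_mem_nhds hlt)] with s (hs : t₁ < s)
  rw [quotient, quotient, glue, glue, if_neg hs.not_ge, if_neg hlt.not_ge]

/-- Points on opposite sides of `t₁` are at `g`-distance at least `Δg(t₁) > 0`, so a small enough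
`δ` never compares the two pieces. -/
theorem ContinuousOn.glue (hD : t₁ ∈ g.D) (hf₁ : g.ContinuousOn T f₁) (hf₂ : g.ContinuousOn T f₂) :
    g.ContinuousOn T (glue t₁ f₁ f₂) := by
  have hfar : ∀ {a b : ℝ}, a ≤ t₁ → t₁ < b → g.jump t₁ ≤ g b - g a := fun ha hb =>
    (g.jump_le hb).trans (sub_le_sub_left (g.mono ha) _)
  intro t ht ε hε
  rcases le_or_gt t t₁ with htt | htt
  · obtain ⟨δ, hδ, H⟩ := hf₁ t ht ε hε
    refine ⟨min δ (g.jump t₁), lt_min hδ hD, fun s hs hst => ?_⟩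
    have hst' := hst.trans_le (min_le_right _ _)
    have hs₁ : s ≤ t₁ := by
      by_contra! hlt
      rw [abs_lt] at hst'
      linarith [hfar htt hlt]
    rw [Derivator.glue, Derivator.glue, if_pos htt, if_pos hs₁]
    exact H s hs (hst.trans_le (min_le_left _ _))
  · obtain ⟨δ, hδ, H⟩ := hf₂ t ht ε hε
    refine ⟨min δ (g.jump t₁), lt_min hδ hD, fun s hs hst => ?_⟩
    have hst' := hst.trans_le (min_le_right _ _)
    have hs₁ : t₁ < s := by
      by_contra! hle
      rw [abs_lt] at hst'
      linarith [hfar hle htt]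
    rw [Derivator.glue, Derivator.glue, if_neg htt.not_ge, if_neg hs₁.not_ge]
    exact H s hs (hst.trans_le (min_le_left _ _))

theorem exists_norm_glue_le (h₁ : ∃ M, ∀ t ∈ Icc 0 T, ‖f₁ t‖ ≤ M)
    (h₂ : ∃ M, ∀ t ∈ Icc 0 T, ‖f₂ t‖ ≤ M) : ∃ M, ∀ t ∈ Icc 0 T, ‖glue t₁ f₁ f₂ t‖ ≤ M := by
  obtain ⟨M₁, h₁⟩ := h₁
  obtain ⟨M₂, h₂⟩ := h₂
  refine ⟨max M₁ M₂, fun t ht => ?_⟩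
  unfold glue
  split_ifs
  · exact (h₁ t ht).trans (le_max_left _ _)
  · exact (h₂ t ht).trans (le_max_right _ _)

end Glue

end Derivator

/-! ### Solutions paired with their `g`-derivatives. -/

theorem exists_norm_add_le {T : ℝ} {f₁ f₂ : ℝ → ℂ} (h₁ : ∃ M, ∀ t ∈ Icc 0 T, ‖f₁ t‖ ≤ M)
    (h₂ : ∃ M, ∀ t ∈ Icc 0 T, ‖f₂ t‖ ≤ M) : ∃ M, ∀ t ∈ Icc 0 T, ‖f₁ t + f₂ t‖ ≤ M := by
  obtain ⟨M₁, h₁⟩ := h₁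
  obtain ⟨M₂, h₂⟩ := h₂
  exact ⟨M₁ + M₂, fun t ht => (norm_add_le _ _).trans (add_le_add (h₁ t ht) (h₂ t ht))⟩

theorem exists_norm_const_mul_le {T : ℝ} {f : ℝ → ℂ} (c : ℂ) (h : ∃ M, ∀ t ∈ Icc 0 T, ‖f t‖ ≤ M) :
    ∃ M, ∀ t ∈ Icc 0 T, ‖c * f t‖ ≤ M := by
  obtain ⟨M, h⟩ := h
  exact ⟨‖c‖ * M, fun t ht => by rw [norm_mul]; gcongr; exact h t ht⟩

/-- `f` solves the Helmholtz equation and `f'` is its `g`-derivative. -/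
structure IsHelmholtzPair (g : Derivator) (T t₁ w₁ w₂ : ℝ) (f f' : ℝ → ℂ) : Prop where
  hasDerivAt : ∀ t ∈ Icc 0 T, g.HasDerivAt T f (f' t) t
  hasDerivAt' : ∀ t ∈ Icc 0 T, g.HasDerivAt T f' (-(helmholtzCoeff t₁ w₁ w₂ t : ℂ) ^ 2 * f t) t
  continuousOn : g.ContinuousOn T f
  continuousOn' : g.ContinuousOn T f'
  bounded : ∃ M, ∀ t ∈ Icc 0 T, ‖f t‖ ≤ M
  bounded' : ∃ M, ∀ t ∈ Icc 0 T, ‖f' t‖ ≤ M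

namespace IsHelmholtzPair

variable {g : Derivator} {T t₁ w₁ w₂ : ℝ} {f f' q q' : ℝ → ℂ}

theorem add (hf : IsHelmholtzPair g T t₁ w₁ w₂ f f') (hq : IsHelmholtzPair g T t₁ w₁ w₂ q q') :
    IsHelmholtzPair g T t₁ w₁ w₂ (fun t => f t + q t) (fun t => f' t + q' t) where
  hasDerivAt t ht := (hf.hasDerivAt t ht).add (hq.hasDerivAt t ht)
  hasDerivAt' t ht := by
    rw [mul_add]
    exact (hf.hasDerivAt' t ht).add (hq.hasDerivAt' t ht)
  continuousOn := hf.continuousOn.add hq.continuousOn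
  continuousOn' := hf.continuousOn'.add hq.continuousOn'
  bounded := exists_norm_add_le hf.bounded hq.bounded
  bounded' := exists_norm_add_le hf.bounded' hq.bounded'

theorem const_mul (c : ℂ) (hf : IsHelmholtzPair g T t₁ w₁ w₂ f f') :
    IsHelmholtzPair g T t₁ w₁ w₂ (fun t => c * f t) (fun t => c * f' t) where
  hasDerivAt t ht := (hf.hasDerivAt t ht).const_mul c
  hasDerivAt' t ht := by
    rw [mul_left_comm]
    exact (hf.hasDerivAt' t ht).const_mul c
  continuousOn := hf.continuousOn.const_mul c
  continuousOn' := hf.continuousOn'.const_mul c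
  bounded := exists_norm_const_mul_le c hf.bounded
  bounded' := exists_norm_const_mul_le c hf.bounded'

theorem congr (h : g.IsAdmissible T) (hf : IsHelmholtzPair g T t₁ w₁ w₂ f f')
    (hq : EqOn q f (Icc 0 T)) (hq' : EqOn q' f' (Icc 0 T)) :
    IsHelmholtzPair g T t₁ w₁ w₂ q q' where
  hasDerivAt t ht := by
    rw [hq' ht]
    exact (hf.hasDerivAt t ht).congr h ht hq
  hasDerivAt' t ht := by
    rw [hq ht]
    exact (hf.hasDerivAt' t ht).congr h ht hq'
  continuousOn := hf.continuousOn.congr hq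
  continuousOn' := hf.continuousOn'.congr hq'
  bounded := hf.bounded.imp fun M hM t ht => by rw [hq ht]; exact hM t ht
  bounded' := hf.bounded'.imp fun M hM t ht => by rw [hq' ht]; exact hM t ht

theorem isHelmholtzSolution (h : g.IsAdmissible T) (hD : t₁ ∈ g.D)
    (hf : IsHelmholtzPair g T t₁ w₁ w₂ f f') : IsHelmholtzSolution g T t₁ w₁ w₂ f := by
  have e1 : EqOn (g.iterDeriv T 1 f) f' (Icc 0 T) := fun t ht => (hf.hasDerivAt t ht).deriv h ht
  have hd1 : ∀ t ∈ Icc 0 T, g.HasDerivAt T (g.iterDeriv T 1 f)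
      (-(helmholtzCoeff t₁ w₁ w₂ t : ℂ) ^ 2 * f t) t := fun t ht =>
    (hf.hasDerivAt' t ht).congr h ht e1
  have e2 : EqOn (g.iterDeriv T 2 f) (fun t => -(helmholtzCoeff t₁ w₁ w₂ t : ℂ) ^ 2 * f t)
      (Icc 0 T) := fun t ht => (hd1 t ht).deriv h ht
  -- The coefficient is discontinuous only at the jump point `t₁`, so the second `g`-derivative is a
  -- glued function and thus `g`-continuous.
  have e3 : EqOn (g.iterDeriv T 2 f)
      (Derivator.glue t₁ (fun t => -(w₁ : ℂ) ^ 2 * f t) fun t => -(w₂ : ℂ) ^ 2 * f t)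
      (Icc 0 T) := fun t ht => by
    rw [e2 ht]
    simp only [helmholtzCoeff, Derivator.glue]
    split_ifs <;> rfl
  refine ⟨⟨⟨⟨hf.continuousOn, fun t ht => (hf.hasDerivAt t ht).differentiableAt,
    hf.continuousOn'.congr e1⟩, fun t ht => (hd1 t ht).differentiableAt,
    Derivator.ContinuousOn.congr (.glue hD (hf.continuousOn.const_mul _)
      (hf.continuousOn.const_mul _)) e3⟩, fun n hn => ?_⟩, fun t ht => ?_⟩
  · interval_cases n
    · exact hf.bounded
    · exact hf.bounded'.imp fun M hM t ht => by rw [e1 ht]; exact hM t ht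
    · refine (Derivator.exists_norm_glue_le (t₁ := t₁) (exists_norm_const_mul_le (-(w₁ : ℂ) ^ 2) hf.bounded)
        (exists_norm_const_mul_le (-(w₂ : ℂ) ^ 2) hf.bounded)).imp fun M hM t ht => ?_
      rw [e3 ht]
      exact hM t ht
  · rw [e2 ht]
    ring

theorem eqOn_zero (hf : IsHelmholtzPair g T t₁ w₁ w₂ f f') (h0 : f 0 = 0) (h0' : f' 0 = 0) :
    EqOn f 0 (Icc 0 T) := by
  -- The constant dominates both the coefficient `1` of `‖f'‖` and the coefficient `w₀²` of `‖f‖`.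
  refine Derivator.eqOn_zero_of_norm_deriv_le (K := 1 + w₁ ^ 2 + w₂ ^ 2) hf.continuousOn
    hf.continuousOn' hf.hasDerivAt hf.hasDerivAt' (by positivity) (fun t ht => ?_) h0 h0'
  have hw : helmholtzCoeff t₁ w₁ w₂ t ^ 2 ≤ w₁ ^ 2 + w₂ ^ 2 := by
    unfold helmholtzCoeff
    split_ifs <;> nlinarith [sq_nonneg w₁, sq_nonneg w₂]
  rw [norm_mul, norm_neg, norm_pow, Complex.norm_real, Real.norm_eq_abs, sq_abs]
  nlinarith [norm_nonneg (f t), norm_nonneg (f' t), sq_nonneg w₁, sq_nonneg w₂,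
    mul_nonneg (norm_nonneg (f' t)) (sq_nonneg w₁), mul_nonneg (norm_nonneg (f' t)) (sq_nonneg w₂),
    mul_le_mul_of_nonneg_right hw (norm_nonneg (f t))]

end IsHelmholtzPair

theorem IsHelmholtzSolution.isHelmholtzPair {g : Derivator} {T t₁ w₁ w₂ : ℝ} {v : ℝ → ℂ}
    (hv : IsHelmholtzSolution g T t₁ w₁ w₂ v) :
    IsHelmholtzPair g T t₁ w₁ w₂ v (g.deriv T v) where
  hasDerivAt t ht := (hv.1.1.1.2.1 t ht).hasDerivAt
  hasDerivAt' t ht := by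
    have := (hv.1.1.2.1 t ht).hasDerivAt
    have e : g.deriv T (g.deriv T v) t + (helmholtzCoeff t₁ w₁ w₂ t : ℂ) ^ 2 * v t = 0 := hv.2 t ht
    rwa [neg_mul, ← eq_neg_of_add_eq_zero_left e]
  continuousOn := hv.1.1.1.1
  continuousOn' := hv.1.1.1.2.2
  bounded := hv.1.2 0 (by norm_num)
  bounded' := hv.1.2 1 (by norm_num)

/-! ### The exponents `±iw`. -/

theorem exists_helmholtzExponent_eq (w : ℝ) (k : Fin 2) :
    ∃ r : ℝ, helmholtzExponent w k = Complex.I * r ∧ r ^ 2 = w ^ 2 := by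
  fin_cases k
  · exact ⟨w, rfl, rfl⟩
  · exact ⟨-w, by simp [helmholtzExponent], neg_sq w⟩

theorem helmholtzExponent_sq (w : ℝ) (k : Fin 2) : helmholtzExponent w k ^ 2 = -(w : ℂ) ^ 2 := by
  obtain ⟨r, e, hr⟩ := exists_helmholtzExponent_eq w k
  rw [e, mul_pow, Complex.I_sq, ← Complex.ofReal_pow, hr]
  simp

theorem helmholtzExponent_sub_ne_zero {w : ℝ} (hw : w ≠ 0) :
    helmholtzExponent w 1 - helmholtzExponent w 0 ≠ 0 := by
  have : helmholtzExponent w 1 - helmholtzExponent w 0 = -(2 * Complex.I * w) := by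
    simp [helmholtzExponent]
    ring
  rw [this]
  simp [hw]

section Exponent

variable {g : Derivator} {T t t₁ : ℝ} (w : ℝ) (k : Fin 2)

theorem one_add_helmholtzExponent_mul_ne_zero (x : ℝ) : 1 + helmholtzExponent w k * x ≠ 0 := by
  obtain ⟨r, e, -⟩ := exists_helmholtzExponent_eq w k
  rw [e]
  exact one_add_I_mul_ne_zero r x

theorem hasDerivAt_gexp_helmholtzExponent (h : g.IsAdmissible T) (ht : t ∈ Icc 0 T) :
    g.HasDerivAt T (g.gexp fun _ => helmholtzExponent w k)
      (helmholtzExponent w k * g.gexp (fun _ => helmholtzExponent w k) t) t := by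
  obtain ⟨r, e, -⟩ := exists_helmholtzExponent_eq w k
  rw [e]
  exact Derivator.hasDerivAt_gexp h r ht

theorem continuousOn_gexp_helmholtzExponent :
    g.ContinuousOn T (g.gexp fun _ => helmholtzExponent w k) := by
  obtain ⟨r, e, -⟩ := exists_helmholtzExponent_eq w k
  rw [e]
  exact g.continuousOn_gexp r T

theorem exists_norm_gexp_helmholtzExponent_le :
    ∃ M, ∀ t ∈ Icc 0 T, ‖g.gexp (fun _ => helmholtzExponent w k) t‖ ≤ M := by
  obtain ⟨r, e, -⟩ := exists_helmholtzExponent_eq w k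
  rw [e]
  exact g.exists_norm_gexp_le r

theorem tendsto_gexp_helmholtzExponent_right (ht0 : 0 ≤ t) (ht : t ∈ g.D) :
    Tendsto (g.gexp fun _ => helmholtzExponent w k) (𝓝[>] t)
      (𝓝 (g.gexp (fun _ => helmholtzExponent w k) t * (1 + helmholtzExponent w k * g.jump t))) := by
  obtain ⟨r, e, -⟩ := exists_helmholtzExponent_eq w k
  rw [e]
  exact g.tendsto_gexp_right r ht0 ht

end Exponent

/-! ### The functions `y_k` and `v_h`. -/

section Solutions

variable {g : Derivator} {T t₁ w₁ w₂ : ℝ}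

/-- The `g`-derivative of `helmholtzY`. -/
noncomputable def helmholtzYDeriv (g : Derivator) (t₁ w₁ w₂ : ℝ) (k : Fin 2) : ℝ → ℂ :=
  Derivator.glue t₁
    (fun s => helmholtzExponent w₁ k * g.gexp (fun _ => helmholtzExponent w₁ k) s)
    (fun s =>
      helmholtzAlpha₁ g t₁ w₁ w₂ k *
        (helmholtzExponent w₂ 0 * g.gexp (fun _ => helmholtzExponent w₂ 0) s) +
      helmholtzAlpha₂ g t₁ w₁ w₂ k *
        (helmholtzExponent w₂ 1 * g.gexp (fun _ => helmholtzExponent w₂ 1) s))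

theorem helmholtzY_eqOn_glue (g : Derivator) (T t₁ w₁ w₂ : ℝ) (k : Fin 2) :
    EqOn (helmholtzY g T t₁ w₁ w₂ k) (Derivator.glue t₁ (g.gexp fun _ => helmholtzExponent w₁ k)
      fun s => helmholtzAlpha₁ g t₁ w₁ w₂ k * g.gexp (fun _ => helmholtzExponent w₂ 0) s +
        helmholtzAlpha₂ g t₁ w₁ w₂ k * g.gexp (fun _ => helmholtzExponent w₂ 1) s) (Icc 0 T) := by
  intro t ht
  rw [helmholtzY, Derivator.glue]
  split_ifs with htt
  · rw [indicator_of_mem (mem_Icc.2 ⟨ht.1, htt⟩), indicator_of_notMem fun hm => hm.1.not_ge htt, add_zero]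
  · rw [indicator_of_notMem fun hm => htt hm.2, indicator_of_mem (mem_Ioc.2 ⟨not_le.1 htt, ht.2⟩), zero_add]

theorem helmholtzY_zero (ht₁ : 0 ≤ t₁) (k : Fin 2) :
    helmholtzY g T t₁ w₁ w₂ k 0 = 1 := by
  rw [helmholtzY, indicator_of_mem (left_mem_Icc.2 ht₁),
    indicator_of_notMem fun hm => hm.1.not_ge ht₁, add_zero, g.gexp_zero]

theorem helmholtzYDeriv_zero (ht₁ : 0 ≤ t₁) (k : Fin 2) :
    helmholtzYDeriv g t₁ w₁ w₂ k 0 = helmholtzExponent w₁ k := by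
  rw [helmholtzYDeriv, Derivator.glue, if_pos ht₁, g.gexp_zero, mul_one]

/-- The coefficients `α₁`, `α₂` match the right limits at `t₁`. -/
theorem helmholtzAlpha_add (hw₂ : w₂ ≠ 0) (k : Fin 2) :
    helmholtzAlpha₁ g t₁ w₁ w₂ k * (g.gexp (fun _ => helmholtzExponent w₂ 0) t₁ *
        (1 + helmholtzExponent w₂ 0 * g.jump t₁)) +
      helmholtzAlpha₂ g t₁ w₁ w₂ k * (g.gexp (fun _ => helmholtzExponent w₂ 1) t₁ *
        (1 + helmholtzExponent w₂ 1 * g.jump t₁)) =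
    g.gexp (fun _ => helmholtzExponent w₁ k) t₁ * (1 + helmholtzExponent w₁ k * g.jump t₁) := by
  have h0 := g.gexp_ne_zero (helmholtzExponent w₂ 0) t₁
  have h1 := g.gexp_ne_zero (helmholtzExponent w₂ 1) t₁
  have h2 := one_add_helmholtzExponent_mul_ne_zero w₂ 0 (g.jump t₁)
  have h3 := one_add_helmholtzExponent_mul_ne_zero w₂ 1 (g.jump t₁)
  have h4 := helmholtzExponent_sub_ne_zero hw₂
  simp only [helmholtzAlpha₁, helmholtzAlpha₂]
  generalize 1 + helmholtzExponent w₂ 0 * (g.jump t₁ : ℂ) = u₀ at h2 ⊢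
  generalize 1 + helmholtzExponent w₂ 1 * (g.jump t₁ : ℂ) = u₁ at h3 ⊢
  field_simp
  ring

/-- The coefficients `α₁`, `α₂` match the right limits of the `g`-derivatives at `t₁`. -/
theorem helmholtzAlpha_add' (hw₂ : w₂ ≠ 0) (k : Fin 2) :
    helmholtzAlpha₁ g t₁ w₁ w₂ k * (helmholtzExponent w₂ 0 *
        (g.gexp (fun _ => helmholtzExponent w₂ 0) t₁ *
          (1 + helmholtzExponent w₂ 0 * g.jump t₁))) +
      helmholtzAlpha₂ g t₁ w₁ w₂ k * (helmholtzExponent w₂ 1 *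
        (g.gexp (fun _ => helmholtzExponent w₂ 1) t₁ *
          (1 + helmholtzExponent w₂ 1 * g.jump t₁))) =
    helmholtzExponent w₁ k *
      (g.gexp (fun _ => helmholtzExponent w₁ k) t₁ *
        (1 + helmholtzExponent w₁ k * g.jump t₁)) := by
  have h0 := g.gexp_ne_zero (helmholtzExponent w₂ 0) t₁
  have h1 := g.gexp_ne_zero (helmholtzExponent w₂ 1) t₁
  have h2 := one_add_helmholtzExponent_mul_ne_zero w₂ 0 (g.jump t₁)
  have h3 := one_add_helmholtzExponent_mul_ne_zero w₂ 1 (g.jump t₁)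
  have h4 := helmholtzExponent_sub_ne_zero hw₂
  simp only [helmholtzAlpha₁, helmholtzAlpha₂]
  generalize 1 + helmholtzExponent w₂ 0 * (g.jump t₁ : ℂ) = u₀ at h2 ⊢
  generalize 1 + helmholtzExponent w₂ 1 * (g.jump t₁ : ℂ) = u₁ at h3 ⊢
  field_simp
  ring

theorem isHelmholtzPair_helmholtzY (h : g.IsAdmissible T) (ht₁ : 0 ≤ t₁) (hD : t₁ ∈ g.D)
    (hw₂ : w₂ ≠ 0) (k : Fin 2) : IsHelmholtzPair g T t₁ w₁ w₂ (helmholtzY g T t₁ w₁ w₂ k)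
      (helmholtzYDeriv g t₁ w₁ w₂ k) := by
  refine IsHelmholtzPair.congr h ?_ (helmholtzY_eqOn_glue g T t₁ w₁ w₂ k) (fun _ _ => rfl)
  have hl₁ := tendsto_gexp_helmholtzExponent_right w₁ k ht₁ hD
  have hP := tendsto_gexp_helmholtzExponent_right w₂ 0 ht₁ hD
  have hQ := tendsto_gexp_helmholtzExponent_right w₂ 1 ht₁ hD
  set a := helmholtzAlpha₁ g t₁ w₁ w₂ k with ha
  set b := helmholtzAlpha₂ g t₁ w₁ w₂ k with hb
  have hl₂ := (hP.const_mul a).add (hQ.const_mul b)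
  have hl₂' := ((hP.const_mul (helmholtzExponent w₂ 0)).const_mul a).add
    ((hQ.const_mul (helmholtzExponent w₂ 1)).const_mul b)
  -- By the choice of the `α`, the right limits at `t₁` of the second piece and of its
  -- `g`-derivative are those of the first piece.
  rw [ha, hb, helmholtzAlpha_add hw₂] at hl₂
  rw [ha, hb, helmholtzAlpha_add' hw₂] at hl₂'
  have hc := @continuousOn_gexp_helmholtzExponent g T
  have hm := @exists_norm_gexp_helmholtzExponent_le g T
  have hd := fun w k t => @hasDerivAt_gexp_helmholtzExponent g T t w k h
  exact
  { hasDerivAt := fun t ht => by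
      rw [helmholtzYDeriv, Derivator.glue]
      split_ifs with htt
      · exact Derivator.hasDerivAt_glue_of_le h hD hl₁ hl₂ ht htt (hd w₁ k t ht)
      · exact Derivator.hasDerivAt_glue_of_lt h ht (not_le.1 htt)
          (((hd w₂ 0 t ht).const_mul a).add ((hd w₂ 1 t ht).const_mul b))
    hasDerivAt' := fun t ht => by
      rw [Derivator.glue, helmholtzCoeff]
      split_ifs with htt
      · rw [← helmholtzExponent_sq w₁ k, sq, mul_assoc]
        exact Derivator.hasDerivAt_glue_of_le h hD (hl₁.const_mul _) hl₂' ht htt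
          ((hd w₁ k t ht).const_mul _)
      · have := Derivator.hasDerivAt_glue_of_lt (f₁ := fun s =>
          helmholtzExponent w₁ k * g.gexp (fun _ => helmholtzExponent w₁ k) s)
          h ht (not_le.1 htt) ((((hd w₂ 0 t ht).const_mul (helmholtzExponent w₂ 0)).const_mul a).add
            (((hd w₂ 1 t ht).const_mul (helmholtzExponent w₂ 1)).const_mul b))
        refine Eq.subst (motive := fun L => g.HasDerivAt T _ L t) ?_ this
        have e0 := helmholtzExponent_sq w₂ 0
        have e1 := helmholtzExponent_sq w₂ 1
        rw [← mul_assoc (helmholtzExponent w₂ 0), ← mul_assoc (helmholtzExponent w₂ 1), ← sq, ← sq,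
          e0, e1]
        ring
    continuousOn := .glue hD (hc w₁ k) (((hc w₂ 0).const_mul a).add ((hc w₂ 1).const_mul b))
    continuousOn' := .glue hD ((hc w₁ k).const_mul _)
      ((((hc w₂ 0).const_mul _).const_mul a).add (((hc w₂ 1).const_mul _).const_mul b))
    bounded := Derivator.exists_norm_glue_le (hm w₁ k)
      (exists_norm_add_le (exists_norm_const_mul_le a (hm w₂ 0))
        (exists_norm_const_mul_le b (hm w₂ 1)))
    bounded' := Derivator.exists_norm_glue_le (exists_norm_const_mul_le _ (hm w₁ k))
      (exists_norm_add_le (exists_norm_const_mul_le a (exists_norm_const_mul_le _ (hm w₂ 0)))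
        (exists_norm_const_mul_le b (exists_norm_const_mul_le _ (hm w₂ 1)))) }

/-- The value and the `g`-derivative at `0` of a vanishing combination give `c 0 + c 1 = 0` and `c 0
λ_1^1 + c 1 λ_1^2 = 0`, a Vandermonde system with distinct nodes. -/
theorem linearIndependent_helmholtzY (h : g.IsAdmissible T) (ht₁ : 0 ≤ t₁) (hD : t₁ ∈ g.D)
    (hw₁ : w₁ ≠ 0) (hw₂ : w₂ ≠ 0) :
    LinearIndependent ℂ (fun k : Fin 2 => (Icc 0 T).domRestrict (helmholtzY g T t₁ w₁ w₂ k)) := by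
  rw [Fintype.linearIndependent_iff]
  intro c hc
  rw [Fin.sum_univ_two] at hc
  have hpt : EqOn (fun t => c 0 * helmholtzY g T t₁ w₁ w₂ 0 t + c 1 * helmholtzY g T t₁ w₁ w₂ 1 t)
      (fun t => 0 * helmholtzY g T t₁ w₁ w₂ 0 t) (Icc 0 T) := fun t ht => by
    simpa using congrFun hc ⟨t, ht⟩
  have h0 : (0 : ℝ) ∈ Icc 0 T := left_mem_Icc.2 h.pos.le
  have hY := fun k => isHelmholtzPair_helmholtzY (w₁ := w₁) h ht₁ hD hw₂ k
  have hd := ((((hY 0).const_mul (c 0)).add ((hY 1).const_mul (c 1))).hasDerivAt 0 h0)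
  have hz := ((((hY 0).const_mul 0).hasDerivAt 0 h0).congr h h0 hpt)
  have e1 := hd.deriv h h0
  rw [hz.deriv h h0, helmholtzYDeriv_zero ht₁, helmholtzYDeriv_zero ht₁] at e1
  have e0 := hpt h0
  simp only [helmholtzY_zero ht₁] at e0
  have hne := helmholtzExponent_sub_ne_zero hw₁
  have hc1 : c 1 = 0 := by
    refine (mul_eq_zero.1 (?_ : (helmholtzExponent w₁ 1 - helmholtzExponent w₁ 0) * c 1 = 0)
      ).resolve_left hne
    linear_combination -e1 - helmholtzExponent w₁ 0 * e0
  have hc0 : c 0 = 0 := by linear_combination e0 - hc1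
  intro i
  fin_cases i
  · exact hc0
  · exact hc1

/-- The `g`-derivative of `helmholtzVh`. -/
noncomputable def helmholtzVhDeriv (g : Derivator) (t₁ w₁ w₂ : ℝ) (x₀ v₀ : ℂ) (t : ℝ) : ℂ :=
  let l := helmholtzExponent w₁
  (l 1 * x₀ - v₀) / (l 1 - l 0) * helmholtzYDeriv g t₁ w₁ w₂ 0 t +
    (v₀ - l 0 * x₀) / (l 1 - l 0) * helmholtzYDeriv g t₁ w₁ w₂ 1 t

theorem isHelmholtzPair_helmholtzVh (h : g.IsAdmissible T) (ht₁ : 0 ≤ t₁) (hD : t₁ ∈ g.D)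
    (hw₂ : w₂ ≠ 0) (x₀ v₀ : ℂ) : IsHelmholtzPair g T t₁ w₁ w₂
      (helmholtzVh g T t₁ w₁ w₂ x₀ v₀) (helmholtzVhDeriv g t₁ w₁ w₂ x₀ v₀) :=
  ((isHelmholtzPair_helmholtzY h ht₁ hD hw₂ 0).const_mul _).add
    ((isHelmholtzPair_helmholtzY h ht₁ hD hw₂ 1).const_mul _)

theorem helmholtzVh_zero (ht₁ : 0 ≤ t₁) (hw₁ : w₁ ≠ 0) (x₀ v₀ : ℂ) :
    helmholtzVh g T t₁ w₁ w₂ x₀ v₀ 0 = x₀ := by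
  have := helmholtzExponent_sub_ne_zero hw₁
  simp only [helmholtzVh, helmholtzY_zero ht₁]
  field_simp
  ring

theorem helmholtzVhDeriv_zero (ht₁ : 0 ≤ t₁) (hw₁ : w₁ ≠ 0) (x₀ v₀ : ℂ) :
    helmholtzVhDeriv g t₁ w₁ w₂ x₀ v₀ 0 = v₀ := by
  have := helmholtzExponent_sub_ne_zero hw₁
  simp only [helmholtzVhDeriv, helmholtzYDeriv_zero ht₁]
  field_simp
  ring

end Solutions

theorem mainTheorem8 (g : Derivator) (T : ℝ) (hT : 0 < T)
    (h0 : (0 : ℝ) ∉ g.D ∪ g.Nminus) (hT' : T ∉ g.Nplus ∪ g.D ∪ g.C)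
    (t₁ : ℝ) (ht₁ : t₁ ∈ Set.Icc 0 T ∩ g.D)
    (w₁ w₂ : ℝ) (hw₁ : w₁ ≠ 0) (hw₂ : w₂ ≠ 0) :
    (∀ k : Fin 2, IsHelmholtzSolution g T t₁ w₁ w₂ (helmholtzY g T t₁ w₁ w₂ k)) ∧
    LinearIndependent ℂ (fun k : Fin 2 => (Set.Icc 0 T).domRestrict (helmholtzY g T t₁ w₁ w₂ k)) ∧
    ∀ x₀ v₀ : ℂ,
      IsHelmholtzIVPSolution g T t₁ w₁ w₂ x₀ v₀ (helmholtzVh g T t₁ w₁ w₂ x₀ v₀) ∧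
      ∀ v : ℝ → ℂ, IsHelmholtzIVPSolution g T t₁ w₁ w₂ x₀ v₀ v →
        Set.EqOn v (helmholtzVh g T t₁ w₁ w₂ x₀ v₀) (Set.Icc 0 T) := by
  have h : g.IsAdmissible T := ⟨hT, h0, hT'⟩
  obtain ⟨⟨ht₀, -⟩, hD⟩ := ht₁
  refine ⟨fun k => (isHelmholtzPair_helmholtzY h ht₀ hD hw₂ k).isHelmholtzSolution h hD,
    linearIndependent_helmholtzY h ht₀ hD hw₁ hw₂, fun x₀ v₀ => ?_⟩
  have hV := isHelmholtzPair_helmholtzVh (w₁ := w₁) h ht₀ hD hw₂ x₀ v₀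
  have hV0 := helmholtzVh_zero (g := g) (T := T) (w₂ := w₂) ht₀ hw₁ x₀ v₀
  have hV0' := helmholtzVhDeriv_zero (g := g) (w₂ := w₂) ht₀ hw₁ x₀ v₀
  refine ⟨⟨hV.isHelmholtzSolution h hD, hV0, ?_⟩, fun v ⟨hv, hv0, hv0'⟩ t ht => ?_⟩
  · rw [(hV.hasDerivAt 0 (left_mem_Icc.2 hT.le)).deriv h (left_mem_Icc.2 hT.le), hV0']
  -- The difference `v - v_h` solves the equation with zero initial data.
  · have := (hv.isHelmholtzPair.add (hV.const_mul (-1))).eqOn_zero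
      (by rw [hv0, hV0]; ring) (by rw [hv0', hV0']; ring) ht
    have e : v t + -1 * helmholtzVh g T t₁ w₁ w₂ x₀ v₀ t = 0 := this
    linear_combination e
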